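/- Let $l,T>0$, let $F_*\le F^*$ and $G_*\le G^*$ be real numbers, and put $\mathbb{L}^2:=L^2(0,l)\times\mathbb{R}^2$ and $\mathbb{L}^2_T:=L^2((0,T)\times(0,l))\times L^2(0,T)$ (with their product Hilbert norms) and $\mathbb{H}^1:=\{(u,u(0),u(l)) : u\in H^1(0,l)\}$. Fix initial data $(Y_0,Y_1)\in\mathbb{H}^1\times\mathbb{L}^2$ and a measurement $Y_T^\delta\in\mathbb{L}^2$. For $\mathcal{W}=(F,G)\in\mathbb{L}^2_T$ consider the mild solution on $[0,T]$, in the energy space $\mathbb{H}^1\times\mathbb{L}^2$, of the wave equation with dynamic boundary conditions $$\begin{cases} y_{tt}(t,x)-y_{xx}(t,x)=F(t,x), & (t,x)\in(0,T)\times(0,l),\\ y_{tt}(t,0)-y_x(t,0)=G(t), & t\in(0,T),\\ y_{tt}(t,l)+y_x(t,l)=0, & t\in(0,T),\\ (y(0,\cdot),y(0,0),y(0,l))=Y_0,\quad (y_t(0,\cdot),y_t(0,0),y_t(0,l))=Y_1; \end{cases}$$ let $Y(T,\cdot,\mathcal{W})=(y(T,\cdot),y(T,0),y(T,l))\in\mathbb{L}^2$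 be its final displacement. Let $$\mathcal{J}(\mathcal{W}):=\tfrac12\|Y(T,\cdot,\mathcal{W})-Y_T^\delta\|_{\mathbb{L}^2}^2,\qquad \mathcal{U}_{\mathrm{ad}}:=\{(F,G)\in\mathbb{L}^2_T : F_*\le F\le F^* \text{ a.e. in } (0,T)\times(0,l),\ G_*\le G\le G^*\text{ a.e. in } (0,T)\}.$$ A quasi-solution is an element $\mathcal{W}_*\in\mathcal{U}_{\mathrm{ad}}$ with $\mathcal{J}(\mathcal{W}_*)=\inf_{\mathcal{W}\in\mathcal{U}_{\mathrm{ad}}}\mathcal{J}(\mathcal{W})$. For $\delta\mathcal{W}\in\mathbb{L}^2_T$ let $\delta Y(T,\cdot)$ be the final displacement of the mild solution of the same system with source $\delta\mathcal{W}$ and zero initial data; it equals $Y(T,\cdot,\mathcal{W}+\delta\mathcal{W})-Y(T,\cdot,\mathcal{W})$ for every $\mathcal{W}$. Then: 1. For every $\mathcal{W}\in\mathbb{L}^2_T$ the mild solution exists and is unique on $[0,T]$, so that $\mathcal{J}$ is well defined; $\mathcal{U}_{\mathrm{ad}}$ is closed and convex in $\mathbb{L}^2_T$, $\mathcal{J}$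 is continuous and convex on $\mathcal{U}_{\mathrm{ad}}$, and there is at least one quasi-solution. 2. Let $\mathcal{V}\subset\mathcal{U}_{\mathrm{ad}}$ be closed and convex, and suppose that $\|\delta Y(T,\cdot)\|_{\mathbb{L}^2}^2>0$ for all $\mathcal{W}\in\mathcal{V}$ and all variations $\delta\mathcal{W}\neq 0$ with $\mathcal{W}+\delta\mathcal{W}\in\mathcal{V}$. Then $\mathcal{J}$ is strictly convex on $\mathcal{V}$ and has at most one minimizer over $\mathcal{V}$; in particular at most one quasi-solution lies in $\mathcal{V}$. -/

import Mathlib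

open MeasureTheory Set

noncomputable section

namespace DynamicWave

/-- The space `L²(0,l)`. -/
abbrev L2 (l : ℝ) : Type :=
  Lp ℝ 2 ((volume : Measure ℝ).restrict (Ioo 0 l))

/-- The Hilbert space `𝕃² = L²(0,l) × ℝ²` of triples `(u, a, b)`, with the inner product
`⟨u, v⟩ + a c + b d`. The interior component of `U` is `U.fst`, the component at `x = 0` is
`U.snd.fst`, the component at `x = l` is `U.snd.snd`. -/
abbrev LL (l : ℝ) : Type := WithLp 2 (L2 l × WithLp 2 (ℝ × ℝ))

/-- The Hilbert space `𝕃²_T = L²((0,T) × (0,l)) × L²(0,T)` of sources `W = (F, G)`, with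
`F = W.fst` and `G = W.snd`. -/
abbrev Source (l T : ℝ) : Type :=
  WithLp 2 (Lp ℝ 2 ((volume : Measure (ℝ × ℝ)).restrict (Ioo 0 T ×ˢ Ioo 0 l)) ×
    Lp ℝ 2 ((volume : Measure ℝ).restrict (Ioo 0 T)))

/-- `U = (u, a, b)` satisfies `u ∈ H¹(0,l)`, `u' = g`, `u(0) = a` and `u(l) = b`:
the absolutely continuous representative of `u` is `x ↦ a + ∫₀ˣ g`, and it takes the value `b`
at `l`. -/
def HasWeakDeriv {l : ℝ} (U : LL l) (g : L2 l) : Prop :=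
  (∀ᵐ x ∂((volume : Measure ℝ).restrict (Ioo 0 l)),
      U.fst x = U.snd.fst + ∫ s in (0 : ℝ)..x, g s) ∧
    U.snd.snd = U.snd.fst + ∫ s in (0 : ℝ)..l, g s

theorem L2.integrableOn {l : ℝ} (g : L2 l) : IntegrableOn (fun x => g x) (Ioo 0 l) :=
  (Lp.memLp g).integrable (by norm_num)

theorem L2.intervalIntegrable {l x : ℝ} (h0 : 0 ≤ x) (hx : x ≤ l) (g : L2 l) :
    IntervalIntegrable (fun s => g s) volume 0 x := by
  rw [intervalIntegrable_iff_integrableOn_Ioo_of_le h0]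
  exact (L2.integrableOn g).mono_set (Ioo_subset_Ioo_right hx)

theorem L2.ae_eq_Ioc {l x : ℝ} (hx : x ≤ l) {p : ℝ → Prop}
    (h : ∀ᵐ s ∂((volume : Measure ℝ).restrict (Ioo 0 l)), p s) :
    ∀ᵐ s ∂((volume : Measure ℝ).restrict (Ioc 0 x)), p s := by
  rw [← restrict_Ioo_eq_restrict_Ioc]
  exact ae_mono (Measure.restrict_mono (Ioo_subset_Ioo_right hx) le_rfl) h

theorem L2.integral_add {l x : ℝ} (h0 : 0 ≤ x) (hx : x ≤ l) (g h : L2 l) :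
    ∫ s in (0 : ℝ)..x, (g + h : L2 l) s = (∫ s in (0 : ℝ)..x, g s) + ∫ s in (0 : ℝ)..x, h s := by
  rw [← intervalIntegral.integral_add (L2.intervalIntegrable h0 hx g)
    (L2.intervalIntegrable h0 hx h)]
  rw [intervalIntegral.integral_of_le h0, intervalIntegral.integral_of_le h0]
  exact integral_congr_ae (L2.ae_eq_Ioc hx (Lp.coeFn_add g h))

theorem L2.integral_smul {l x : ℝ} (h0 : 0 ≤ x) (hx : x ≤ l) (c : ℝ) (g : L2 l) :
    ∫ s in (0 : ℝ)..x, (c • g : L2 l) s = c * ∫ s in (0 : ℝ)..x, g s := by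
  rw [← intervalIntegral.integral_const_mul]
  rw [intervalIntegral.integral_of_le h0, intervalIntegral.integral_of_le h0]
  exact integral_congr_ae (L2.ae_eq_Ioc hx (Lp.coeFn_smul c g))

theorem L2.integral_zero {l x : ℝ} (h0 : 0 ≤ x) (hx : x ≤ l) :
    ∫ s in (0 : ℝ)..x, (0 : L2 l) s = 0 := by
  have := L2.integral_smul h0 hx 0 (0 : L2 l)
  simpa using this

/-- The Hilbert space `ℍ¹ = {(u, u(0), u(l)) : u ∈ H¹(0,l)}`, each element being stored together
with its weak derivative `u'`, so that the norm is
`(‖u‖² + u(0)² + u(l)² + ‖u'‖²)^(1/2)`. (The interval is assumed to satisfy `0 < l`.) -/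
def H1 (l : ℝ) [Fact (0 < l)] : Submodule ℝ (WithLp 2 (LL l × L2 l)) where
  carrier := {p | HasWeakDeriv p.fst p.snd}
  zero_mem' := by
    have hl : (0 : ℝ) < l := Fact.out
    refine ⟨?_, ?_⟩
    · filter_upwards [Lp.coeFn_zero ℝ 2 ((volume : Measure ℝ).restrict (Ioo 0 l)),
        ae_restrict_mem measurableSet_Ioo] with x h1 hx
      simp only [WithLp.zero_fst, WithLp.zero_snd, L2.integral_zero hx.1.le hx.2.le]
      simpa using h1
    · have h := L2.integral_zero hl.le le_rfl
      simp only [WithLp.zero_fst, WithLp.zero_snd]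
      rw [h, zero_add]
  add_mem' := by
    have hl : (0 : ℝ) < l := Fact.out
    rintro p q ⟨hp, hp'⟩ ⟨hq, hq'⟩
    refine ⟨?_, ?_⟩
    · filter_upwards [hp, hq, Lp.coeFn_add p.fst.fst q.fst.fst,
        ae_restrict_mem measurableSet_Ioo] with x h1 h2 h3 hx
      simp only [WithLp.add_fst, WithLp.add_snd, L2.integral_add hx.1.le hx.2.le] at *
      rw [h3, Pi.add_apply, h1, h2]
      ring
    · simp only [WithLp.add_fst, WithLp.add_snd, L2.integral_add hl.le le_rfl] at *
      rw [hp', hq']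
      ring
  smul_mem' := by
    have hl : (0 : ℝ) < l := Fact.out
    rintro c p ⟨hp, hp'⟩
    refine ⟨?_, ?_⟩
    · filter_upwards [hp, Lp.coeFn_smul c p.fst.fst,
        ae_restrict_mem measurableSet_Ioo] with x h1 h3 hx
      simp only [WithLp.smul_fst, WithLp.smul_snd, L2.integral_smul hx.1.le hx.2.le] at *
      rw [h3, Pi.smul_apply, h1]
      simp only [smul_eq_mul]
      ring
    · simp only [WithLp.smul_fst, WithLp.smul_snd, L2.integral_smul hl.le le_rfl] at *
      rw [hp']
      simp only [smul_eq_mul]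
      ring

/-- The triple `(u, u(0), u(l)) ∈ 𝕃²` of an element of `ℍ¹`. -/
def H1.toLL {l : ℝ} [Fact (0 < l)] (Y : H1 l) : LL l := (Y : WithLp 2 (LL l × L2 l)).fst

/-- The graph of the operator `ℬ (u, u(0), u(l)) = (u'', u'(0), -u'(l))` with domain
`ℍ² = {(u, u(0), u(l)) : u ∈ H²(0,l)}`: `U ∈ ℍ²` and `ℬ U = V`.
Here `U' = (u', u'(0), u'(l))`. -/
def IsB {l : ℝ} (U V : LL l) : Prop :=
  ∃ U' : LL l, HasWeakDeriv U U'.fst ∧ HasWeakDeriv U' V.fst ∧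
    V.snd.fst = U'.snd.fst ∧ V.snd.snd = -U'.snd.snd

/-- `(Y, Z)` is the mild solution in the energy space `ℍ¹ × 𝕃²` of
`y_tt - y_xx = F` in `(0,T) × (0,l)`, `y_tt(t,0) - y_x(t,0) = G(t)`, `y_tt(t,l) + y_x(t,l) = 0`,
`(y, y(·,0), y(·,l)) = Y₀` and `(y_t, y_t(·,0), y_t(·,l)) = Y₁` at `t = 0`.

With `𝒜 (Y, Z) = (Z, ℬ Y)`, `D(𝒜) = ℍ² × ℍ¹`, and `𝓕 = (0, 0, 0, F, G, 0)`, this is the usual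
notion of a mild solution of `𝐘' = 𝒜 𝐘 + 𝓕`, `𝐘(0) = 𝐘₀`: `𝐘` is continuous on `[0,T]` with
values in the energy space, and for all `t ∈ [0,T]`
`∫₀ᵗ 𝐘 ∈ D(𝒜)` and `𝐘(t) = 𝐘₀ + 𝒜 ∫₀ᵗ 𝐘 + ∫₀ᵗ 𝓕`.
(That `∫₀ᵗ Z ∈ ℍ¹` follows from `displacement_eq`.) -/
structure IsMildSolution {l : ℝ} [Fact (0 < l)] (T : ℝ) (Y₀ : H1 l) (Y₁ : LL l)
    (W : Source l T) (Y : ℝ → H1 l) (Z : ℝ → LL l) : Prop where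
  continuousOn_displacement : ContinuousOn Y (Icc 0 T)
  continuousOn_velocity : ContinuousOn Z (Icc 0 T)
  displacement_eq : ∀ t ∈ Icc 0 T, H1.toLL (Y t) = H1.toLL Y₀ + ∫ s in (0 : ℝ)..t, Z s
  velocity_eq : ∀ t ∈ Icc 0 T, ∃ V : LL l, IsB (∫ s in (0 : ℝ)..t, H1.toLL (Y s)) V ∧
    (∀ᵐ x ∂((volume : Measure ℝ).restrict (Ioo 0 l)),
      (Z t).fst x = Y₁.fst x + V.fst x + ∫ s in (0 : ℝ)..t, W.fst (s, x)) ∧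
    (Z t).snd.fst = Y₁.snd.fst + V.snd.fst + ∫ s in (0 : ℝ)..t, W.snd s ∧
    (Z t).snd.snd = Y₁.snd.snd + V.snd.snd

open Classical in
/-- The displacement `t ↦ Y(t, ·, W) = (y(t,·), y(t,0), y(t,l))` of the mild solution with initial
data `(Y₀, Y₁)` and source `W`. It is determined by the data on `[0,T]`. -/
def displacement {l : ℝ} [Fact (0 < l)] (T : ℝ) (Y₀ : H1 l) (Y₁ : LL l) (W : Source l T) :
    ℝ → H1 l :=
  if h : ∃ Y : ℝ → H1 l, ∃ Z : ℝ → LL l, IsMildSolution T Y₀ Y₁ W Y Z then h.choose else 0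

/-- The final displacement `Y(T, ·, W) ∈ 𝕃²`. -/
def finalDisplacement {l : ℝ} [Fact (0 < l)] (T : ℝ) (Y₀ : H1 l) (Y₁ : LL l)
    (W : Source l T) : LL l :=
  H1.toLL (displacement T Y₀ Y₁ W T)

/-- The final displacement `δY(T, ·)` of the sensitivity problem: zero initial data,
source `δW`. -/
def sensitivity {l : ℝ} [Fact (0 < l)] (T : ℝ) (δW : Source l T) : LL l :=
  finalDisplacement T 0 0 δW

/-- The cost functional `𝒥(W) = ½ ‖Y(T, ·, W) - Y_T^δ‖²`, with noisy measurement `Y_T^δ = M`. -/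
def cost {l : ℝ} [Fact (0 < l)] (T : ℝ) (Y₀ : H1 l) (Y₁ : LL l) (M : LL l)
    (W : Source l T) : ℝ :=
  1 / 2 * ‖finalDisplacement T Y₀ Y₁ W - M‖ ^ 2

/-- The set of admissible sources: `F_* ≤ F ≤ F^*` a.e. in `(0,T) × (0,l)` and
`G_* ≤ G ≤ G^*` a.e. in `(0,T)`. -/
def admissible (l T Fmin Fmax Gmin Gmax : ℝ) : Set (Source l T) :=
  {W | (∀ᵐ p ∂((volume : Measure (ℝ × ℝ)).restrict (Ioo 0 T ×ˢ Ioo 0 l)),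
        Fmin ≤ W.fst p ∧ W.fst p ≤ Fmax) ∧
      (∀ᵐ t ∂((volume : Measure ℝ).restrict (Ioo 0 T)), Gmin ≤ W.snd t ∧ W.snd t ≤ Gmax)}

/-- `W` is a quasi-solution: `W` is admissible and `𝒥(W) = inf 𝒥` over the set `U` of admissible
sources. -/
def IsQuasiSolution {l : ℝ} [Fact (0 < l)] (T : ℝ) (Y₀ : H1 l) (Y₁ : LL l) (M : LL l)
    (U : Set (Source l T)) (W : Source l T) : Prop :=
  W ∈ U ∧ IsMinOn (cost T Y₀ Y₁ M) U W

end DynamicWave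

end

/-! The optimization rests on one fact: the final displacement is `c + L W` with `L` bounded, linear
and equal to the sensitivity map (`exists_finalDisplacement_eq`). The cost is then half the squared
norm of an affine map, and its convexity defect between `W` and `W'` is exactly `a * b / 2` times
the squared norm of the sensitivity of `W - W'` (`cost_combo`). Convexity, strict convexity and
uniqueness follow. A minimizer exists because the admissible set is nonempty, closed, convex and
bounded (`exists_isMinOn_of_convexOn`): the near-minimal sublevel sets are nested, and their
elements of least norm form a Cauchy sequence, so no weak compactness is needed.

For well-posedness, let `J = emb` embed ℍ¹ into 𝕃² and let `R = adj` be its adjoint. Green's formula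
gives `R = (1 - ℬ)⁻¹` (`isB_iff`). The first-order generator is therefore `K⁻¹ + K π`, where `K (y,
z) = (-R z, J y)` is bounded, skew and injective, and `π (y, z) = (y, 0)`. Applying `K` to the
time-integrated equation leaves only bounded operators; this form is equivalent to the mild one
(`isIntegralSolution_iff`, `isMildSolution_iff`). Uniqueness is an energy estimate for `∫ u`. For
initial data, `K⁻¹` is regularized to `(K - ε)⁻¹`, and the exponentials of the resulting bounded
generators converge when the data lie in the range of `K²`, which is dense. For sources, step
functions in time are solved by delayed primitives of the semigroup; the Duhamel formula bounds
their sums by the L² norm of the source, and density gives the rest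
(`exists_integralSolution_source`). -/

noncomputable section

namespace DynamicWave

/-! ### Integrated evolution equations with a bounded skew operator: energy, uniqueness, resolvents.
-/

section Abstract

variable {E : Type*} [NormedAddCommGroup E] [InnerProductSpace ℝ E]

/-- Gronwall: `exp (-γ t) ‖d‖² - c² t` is nonincreasing. The `+ 1` in the rate comes from `2 c ‖d‖ ≤
‖d‖² + c²`. -/
theorem energy_estimate {T β c : ℝ} {d d' : ℝ → E} (hd : ContinuousOn d (Icc 0 T))
    (hd' : ∀ t ∈ Ioo 0 T, HasDerivAt d (d' t) t)
    (h : ∀ t ∈ Ioo 0 T, inner ℝ (d t) (d' t) ≤ β * ‖d t‖ ^ 2 + c * ‖d t‖)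
    {t : ℝ} (ht : t ∈ Icc 0 T) :
    ‖d t‖ ^ 2 ≤ Real.exp ((2 * |β| + 1) * t) * (‖d 0‖ ^ 2 + c ^ 2 * t) := by
  set γ := 2 * |β| + 1 with hγ
  have hγ0 : 0 ≤ γ := by positivity
  have hT : 0 ≤ T := ht.1.trans ht.2
  have key : AntitoneOn (fun t => Real.exp (-(γ * t)) * ‖d t‖ ^ 2 - c ^ 2 * t) (Icc 0 T) := by
    have hder : ∀ s ∈ Ioo 0 T, HasDerivAt (fun t => Real.exp (-(γ * t)) * ‖d t‖ ^ 2 - c ^ 2 * t)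
        (Real.exp (-(γ * s)) * (-(γ * 1)) * ‖d s‖ ^ 2
          + Real.exp (-(γ * s)) * (2 * inner ℝ (d s) (d' s)) - c ^ 2 * 1) s := by
      intro s hs
      have h1 : HasDerivAt (fun t => ‖d t‖ ^ 2) (2 * inner ℝ (d s) (d' s)) s :=
        (hd' s hs).norm_sq
      exact ((((hasDerivAt_id s).const_mul γ).neg.exp).mul h1).sub
        ((hasDerivAt_id s).const_mul (c ^ 2))
    apply antitoneOn_of_deriv_nonpos (convex_Icc 0 T)
    · apply ContinuousOn.sub
      · exact (Continuous.continuousOn (by fun_prop)).mul (hd.norm.pow 2)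
      · exact Continuous.continuousOn (by fun_prop)
    · rw [interior_Icc]
      exact fun s hs => (hder s hs).differentiableAt.differentiableWithinAt
    · rw [interior_Icc]
      intro s hs
      rw [(hder s hs).deriv]
      have h1 := h s hs
      have he : Real.exp (-(γ * s)) ≤ 1 :=
        Real.exp_le_one_iff.2 (by have := mul_nonneg hγ0 hs.1.le; linarith)
      have h2 : 2 * inner ℝ (d s) (d' s) ≤ γ * ‖d s‖ ^ 2 + c ^ 2 := by
        have := mul_le_mul_of_nonneg_right (le_abs_self β) (sq_nonneg ‖d s‖)
        nlinarith [sq_nonneg (‖d s‖ - c)]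
      have h3 := mul_le_mul_of_nonneg_left h2 (Real.exp_pos (-(γ * s))).le
      have h4 := mul_le_mul_of_nonneg_right he (sq_nonneg c)
      nlinarith
  have h1 := key (left_mem_Icc.2 hT) ht ht.1
  simp only [mul_zero, neg_zero, Real.exp_zero, one_mul, sub_zero] at h1
  have h2 : Real.exp (-(γ * t)) * ‖d t‖ ^ 2 ≤ ‖d 0‖ ^ 2 + c ^ 2 * t := by linarith
  calc ‖d t‖ ^ 2 = Real.exp (γ * t) * (Real.exp (-(γ * t)) * ‖d t‖ ^ 2) := by
        rw [← mul_assoc, ← Real.exp_add]; simp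
    _ ≤ _ := mul_le_mul_of_nonneg_left h2 (Real.exp_pos _).le

/-- With `A = K⁻¹ + K π`, the equation `u' = A u + f` integrated in time and multiplied by the
bounded operator `K`; here `c t` stands for `K (u 0 + ∫₀ᵗ f)`. -/
structure IsIntegralSolution (K π : E →L[ℝ] E) (T : ℝ) (c u : ℝ → E) : Prop where
  continuousOn : ContinuousOn u (Icc 0 T)
  eq : ∀ t ∈ Icc 0 T, K (u t) = c t + ∫ s in (0 : ℝ)..t, (u s + K (K (π (u s))))

theorem intervalIntegrable_of_continuousOn_Icc {E : Type*} [NormedAddCommGroup E] {T t : ℝ}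
    (ht : t ∈ Icc 0 T) {u : ℝ → E}
    (hu : ContinuousOn u (Icc 0 T)) : IntervalIntegrable u volume 0 t :=
  (hu.mono (by rw [uIcc_of_le ht.1]; exact Icc_subset_Icc_right ht.2)).intervalIntegrable

theorem IsIntegralSolution.continuousOn_integrand {K π : E →L[ℝ] E} {T : ℝ} {c u : ℝ → E}
    (h : IsIntegralSolution K π T c u) :
    ContinuousOn (fun s => u s + K (K (π (u s)))) (Icc 0 T) :=
  h.continuousOn.add ((K ∘L K ∘L π).continuous.comp_continuousOn h.continuousOn)

theorem IsIntegralSolution.add {K π : E →L[ℝ] E} {T : ℝ} {c u d v : ℝ → E}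
    (h : IsIntegralSolution K π T c u) (h' : IsIntegralSolution K π T d v) :
    IsIntegralSolution K π T (fun t => c t + d t) (fun t => u t + v t) := by
  refine ⟨h.continuousOn.add h'.continuousOn, fun t ht => ?_⟩
  have := intervalIntegral.integral_add
    (intervalIntegrable_of_continuousOn_Icc ht h.continuousOn_integrand)
    (intervalIntegrable_of_continuousOn_Icc ht h'.continuousOn_integrand)
  rw [map_add, h.eq t ht, h'.eq t ht, add_add_add_comm, ← this]
  congr 1
  refine intervalIntegral.integral_congr fun s _ => ?_
  simp only [map_add]
  abel

theorem IsIntegralSolution.smul {K π : E →L[ℝ] E} {T : ℝ} {c u : ℝ → E}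
    (h : IsIntegralSolution K π T c u) (a : ℝ) :
    IsIntegralSolution K π T (fun t => a • c t) (fun t => a • u t) := by
  refine ⟨h.continuousOn.const_smul a, fun t ht => ?_⟩
  rw [map_smul, h.eq t ht, smul_add, ← intervalIntegral.integral_smul]
  simp only [map_smul, smul_add]

theorem IsIntegralSolution.congr_data {K π : E →L[ℝ] E} {T : ℝ} {c d u : ℝ → E}
    (h : IsIntegralSolution K π T c u) (hcd : ∀ t ∈ Icc 0 T, c t = d t) :
    IsIntegralSolution K π T d u :=
  ⟨h.continuousOn, fun t ht => by rw [← hcd t ht, h.eq t ht]⟩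

theorem IsIntegralSolution.congr {K π : E →L[ℝ] E} {T : ℝ} {c u v : ℝ → E}
    (h : IsIntegralSolution K π T c u) (huv : EqOn u v (Icc 0 T)) :
    IsIntegralSolution K π T c v := by
  refine ⟨h.continuousOn.congr huv.symm, fun t ht => ?_⟩
  rw [← huv ht, h.eq t ht]
  congr 1
  refine intervalIntegral.integral_congr fun s hs => ?_
  rw [uIcc_of_le ht.1] at hs
  simp only [huv (Icc_subset_Icc_right ht.2 hs)]

theorem IsIntegralSolution.sum {ι : Type*} {K π : E →L[ℝ] E} {T : ℝ} {c u : ι → ℝ → E}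
    (s : Finset ι) (h : ∀ i ∈ s, IsIntegralSolution K π T (c i) (u i)) :
    IsIntegralSolution K π T (fun t => ∑ i ∈ s, c i t) (fun t => ∑ i ∈ s, u i t) := by
  classical
  induction s using Finset.induction_on with
  | empty => exact ⟨by simpa using continuousOn_const, fun t _ => by simp⟩
  | insert i s his ih =>
    simp only [Finset.sum_insert his]
    exact (h i (Finset.mem_insert_self i s)).add
      (ih fun j hj => h j (Finset.mem_insert_of_mem hj))

theorem IsIntegralSolution.of_tendsto {K π : E →L[ℝ] E} {T : ℝ} {c u : ℝ → E}
    {cn un : ℕ → ℝ → E} (h : ∀ n, IsIntegralSolution K π T (cn n) (un n))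
    (hu : TendstoUniformlyOn un u Filter.atTop (Icc 0 T))
    (hc : ∀ t ∈ Icc 0 T, Filter.Tendsto (fun n => cn n t) Filter.atTop (nhds (c t))) :
    IsIntegralSolution K π T c u := by
  have hcont : ContinuousOn u (Icc 0 T) :=
    hu.continuousOn (Filter.Frequently.of_forall fun n => (h n).continuousOn)
  refine ⟨hcont, fun t ht => ?_⟩
  have hN : UniformContinuous fun x : E => x + K (K (π x)) :=
    uniformContinuous_id.add (K ∘L K ∘L π).uniformContinuous
  have h1 : Filter.Tendsto (fun n => ∫ s in (0 : ℝ)..t, (un n s + K (K (π (un n s)))))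
      Filter.atTop (nhds (∫ s in (0 : ℝ)..t, (u s + K (K (π (u s)))))) := by
    have hunif : TendstoUniformlyOn (fun n s => un n s + K (K (π (un n s))))
      (fun s => u s + K (K (π (u s)))) Filter.atTop (Icc 0 T) := hN.comp_tendstoUniformlyOn hu
    have hsub : uIcc 0 t ⊆ Icc 0 T := by
      rw [uIcc_of_le ht.1]
      exact Icc_subset_Icc_right ht.2
    exact (hunif.mono hsub).tendsto_intervalIntegral_of_continuousOn
      (Filter.Eventually.of_forall fun n => (h n).continuousOn_integrand.mono hsub)
  refine tendsto_nhds_unique ((K.continuous.tendsto _).comp (hu.tendsto_at ht)) ?_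
  refine ((hc t ht).add h1).congr fun n => ?_
  exact ((h n).eq t ht).symm

/-- The primitive `v = ∫ u` satisfies `v' = u` and `v = K (u - K π v)`. Skewness makes `v`
orthogonal to `u - K π v`, so `⟨v, v'⟩ = ⟨v, K π v⟩` and the energy estimate gives `v = 0`. Then `K
u = 0`. -/
theorem IsIntegralSolution.eqOn_zero [CompleteSpace E] {K π : E →L[ℝ] E}
    (hK : ∀ x, inner ℝ (K x) x = 0) (hinj : Function.Injective K) {T : ℝ} {u : ℝ → E}
    (h : IsIntegralSolution K π T (fun _ => 0) u) : EqOn u 0 (Icc 0 T) := by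
  have hu := h.continuousOn
  set v : ℝ → E := fun t => ∫ s in (0 : ℝ)..t, u s with hv
  have hvd : ∀ t ∈ Ioo 0 T, HasDerivAt v (u t) t := by
    intro t ht
    have hn : Icc 0 T ∈ nhds t := Icc_mem_nhds ht.1 ht.2
    exact intervalIntegral.integral_hasDerivAt_right
      (intervalIntegrable_of_continuousOn_Icc (Ioo_subset_Icc_self ht) hu)
      (hu.stronglyMeasurableAtFilter_nhdsWithin measurableSet_Icc t |>.filter_mono
        (by rw [nhdsWithin_eq_nhds.2 hn]))
      (hu.continuousAt hn)
  have heq : ∀ t ∈ Icc 0 T, K (u t) = v t + K (K (π (v t))) := by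
    intro t ht
    have hi := intervalIntegrable_of_continuousOn_Icc ht hu
    have h2 := (K ∘L K ∘L π).intervalIntegral_comp_comm hi
    have h1 := intervalIntegral.integral_add hi
      (intervalIntegrable_of_continuousOn_Icc ht
        ((K ∘L K ∘L π).continuous.comp_continuousOn hu))
    rw [h.eq t ht, zero_add]
    exact h1.trans (congrArg _ h2)
  have hvc : ContinuousOn v (Icc 0 T) := by
    rcases le_or_gt 0 T with hT | hT
    · have := intervalIntegral.continuousOn_primitive_interval' (μ := volume) (a := 0)
        (intervalIntegrable_of_continuousOn_Icc (right_mem_Icc.2 hT) hu) left_mem_uIcc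
      rwa [uIcc_of_le hT] at this
    · simp [Icc_eq_empty (not_le.2 hT)]
  have hv0 : ∀ t ∈ Icc 0 T, v t = 0 := by
    intro t ht
    have := energy_estimate (β := ‖K ∘L π‖) (c := 0) hvc hvd (fun s hs => by
      have h1 : v s = K (u s - K (π (v s))) := by
        rw [map_sub, heq s (Ioo_subset_Icc_self hs)]
        abel
      have h2 : inner ℝ (v s) (u s) = inner ℝ (v s) ((K ∘L π) (v s)) := by
        have h3 : inner ℝ (v s) (u s - K (π (v s))) = 0 := by
          nth_rewrite 1 [h1]
          exact hK _
        rw [inner_sub_right] at h3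
        exact sub_eq_zero.1 h3
      rw [h2, zero_mul, add_zero]
      calc _ ≤ ‖v s‖ * ‖(K ∘L π) (v s)‖ := real_inner_le_norm _ _
        _ ≤ ‖v s‖ * (‖K ∘L π‖ * ‖v s‖) := by gcongr; exact (K ∘L π).le_opNorm _
        _ = _ := by ring) ht
    have h0 : v 0 = 0 := by simp [hv]
    simp only [h0, norm_zero] at this
    have h3 : ‖v t‖ ^ 2 ≤ 0 := by simpa using this
    have h4 : ‖v t‖ = 0 := by nlinarith [sq_nonneg ‖v t‖]
    exact norm_eq_zero.1 h4
  intro t ht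
  apply hinj
  rw [heq t ht, hv0 t ht]
  simp

/-- Lax–Milgram: the form `⟨(ε - K) x, y⟩` is coercive with constant `ε`, since `K` does not
contribute on the diagonal. -/
theorem exists_resolvent [CompleteSpace E] (K : E →L[ℝ] E) (hK : ∀ x, inner ℝ (K x) x = 0)
    {ε : ℝ} (hε : 0 < ε) :
    ∃ P : E →L[ℝ] E, (∀ x, K (P x) - ε • P x = x) ∧ (∀ x, P (K x - ε • x) = x) := by
  set B : E →L[ℝ] E →L[ℝ] ℝ := (innerSL ℝ) ∘L (ε • ContinuousLinearMap.id ℝ E - K) with hB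
  have hc : IsCoercive B := by
    refine ⟨ε, hε, fun x => ?_⟩
    have : B x x = inner ℝ (ε • x - K x) x := rfl
    rw [this, inner_sub_left, hK, inner_smul_left, sub_zero, real_inner_self_eq_norm_sq]
    simp [sq, mul_assoc]
  set e := hc.continuousLinearEquivOfBilin with he
  have hval : ∀ x, e x = ε • x - K x := by
    intro x
    refine ext_inner_right ℝ fun w => ?_
    rw [he, hc.continuousLinearEquivOfBilin_apply]
    rfl
  refine ⟨-(e.symm : E →L[ℝ] E), fun x => ?_, fun x => ?_⟩
  · have := hval (e.symm x)
    rw [e.apply_symm_apply] at this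
    simp only [neg_apply, ContinuousLinearEquiv.coe_coe, map_neg, smul_neg]
    conv_rhs => rw [this]
    abel
  · have : K x - ε • x = -(e x) := by rw [hval]; abel
    simp [this]

/-- Pythagoras, as `K x` is orthogonal to `x`. It yields the two `ε`-uniform bounds on `ε P` and `K
P`. -/
theorem norm_sub_smul_sq {K : E →L[ℝ] E} (hK : ∀ x, inner ℝ (K x) x = 0) (ε : ℝ) (x : E) :
    ‖K x - ε • x‖ ^ 2 = ‖K x‖ ^ 2 + (ε * ‖x‖) ^ 2 := by
  rw [norm_sub_sq_real, inner_smul_right, hK, norm_smul, mul_pow, mul_pow, Real.norm_eq_abs, sq_abs]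
  ring

section Resolvent

variable {K P : E →L[ℝ] E} {ε : ℝ}

theorem resolvent_comm (hP : ∀ x, K (P x) - ε • P x = x) (hP' : ∀ x, P (K x - ε • x) = x) (x : E) :
    P (K x) = K (P x) := by
  have h := hP' x
  rw [map_sub, map_smul] at h
  rw [sub_eq_iff_eq_add.1 h, sub_eq_iff_eq_add.1 (hP x)]

theorem norm_mul_resolvent_le (hK : ∀ x, inner ℝ (K x) x = 0) (hP : ∀ x, K (P x) - ε • P x = x)
    (x : E) : ε * ‖P x‖ ≤ ‖x‖ := by
  have h := norm_sub_smul_sq hK ε (P x)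
  rw [hP] at h
  exact le_of_sq_le_sq (by nlinarith [sq_nonneg ‖K (P x)‖]) (norm_nonneg x)

theorem norm_comp_resolvent_le (hK : ∀ x, inner ℝ (K x) x = 0) (hP : ∀ x, K (P x) - ε • P x = x)
    (x : E) : ‖K (P x)‖ ≤ ‖x‖ := by
  have h := norm_sub_smul_sq hK ε (P x)
  rw [hP] at h
  exact le_of_sq_le_sq (by nlinarith [sq_nonneg (ε * ‖P x‖)]) (norm_nonneg x)

end Resolvent

end Abstract

/-! ### Bounded approximations of the generator and their exponentials. -/

section Generator

variable {E : Type*} [NormedAddCommGroup E] [InnerProductSpace ℝ E]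

/-- The bounded approximation `(K - ε)⁻¹ (1 + K² π)` of `K⁻¹ + K π`, where `P = (K - ε)⁻¹`. -/
def approxGenerator (K π P : E →L[ℝ] E) : E →L[ℝ] E :=
  P ∘L (ContinuousLinearMap.id ℝ E + K ∘L K ∘L π)

theorem approxGenerator_apply (K π P : E →L[ℝ] E) (x : E) :
    approxGenerator K π P x = P (x + K (K (π x))) := rfl

variable {K π P Q : E →L[ℝ] E} {ε δ T : ℝ}

theorem resolvent_approxGenerator (hP : ∀ x, K (P x) - ε • P x = x) (x : E) :
    K (approxGenerator K π P x) - ε • approxGenerator K π P x = x + K (K (π x)) := hP _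

theorem norm_comp_apply_le (K π : E →L[ℝ] E) (x : E) : ‖K (π x)‖ ≤ ‖K ∘L π‖ * ‖x‖ :=
  (K ∘L π).le_opNorm x

theorem norm_resolvent_comp_le (hK : ∀ x, inner ℝ (K x) x = 0) (hP : ∀ x, K (P x) - ε • P x = x)
    (hP' : ∀ x, P (K x - ε • x) = x) (x : E) : ‖P (K x)‖ ≤ ‖x‖ := by
  rw [resolvent_comm hP hP']
  exact norm_comp_resolvent_le hK hP x

/-- Writing `x = (K - ε) P x` gives `⟨x, P x⟩ = -ε ‖P x‖² ≤ 0`; the other term is controlled by `‖P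
K‖ ≤ 1`. The bound does not depend on `ε`. -/
theorem inner_approxGenerator_le (hK : ∀ x, inner ℝ (K x) x = 0) (hε : 0 ≤ ε)
    (hP : ∀ x, K (P x) - ε • P x = x) (hP' : ∀ x, P (K x - ε • x) = x) (x : E) :
    inner ℝ x (approxGenerator K π P x) ≤ ‖K ∘L π‖ * ‖x‖ ^ 2 := by
  rw [approxGenerator_apply, map_add, inner_add_right]
  have h1 : inner ℝ x (P x) ≤ 0 := by
    nth_rewrite 1 [← hP x]
    rw [inner_sub_left, hK, inner_smul_left, real_inner_self_eq_norm_sq]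
    have := mul_nonneg hε (sq_nonneg ‖P x‖)
    simpa using this
  have h2 : inner ℝ x (P (K (K (π x)))) ≤ ‖K ∘L π‖ * ‖x‖ ^ 2 :=
    calc _ ≤ ‖x‖ * ‖P (K (K (π x)))‖ := real_inner_le_norm _ _
      _ ≤ ‖x‖ * (‖K ∘L π‖ * ‖x‖) := by
        gcongr
        exact (norm_resolvent_comp_le hK hP hP' _).trans (norm_comp_apply_le K π x)
      _ = _ := by ring
  linarith

/-- The resolvent identity, applied to `x + K² π x`. -/
theorem approxGenerator_sub (hP' : ∀ x, P (K x - ε • x) = x) (hQ : ∀ x, K (Q x) - δ • Q x = x)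
    (x : E) : approxGenerator K π P x - approxGenerator K π Q x
      = (ε - δ) • P (approxGenerator K π Q x) := by
  have h1 := resolvent_approxGenerator (π := π) hQ x
  have h2 := hP' (approxGenerator K π Q x)
  rw [approxGenerator_apply K π P, ← h1]
  generalize approxGenerator K π Q x = w at h2 ⊢
  simp only [map_sub, map_smul] at h2 ⊢
  rw [sub_eq_iff_eq_add.1 h2]
  module

theorem exp_smul_apply_comm (A : E →L[ℝ] E) (x : E) (t : ℝ) :
    A (NormedSpace.exp (t • A) x) = NormedSpace.exp (t • A) (A x) := by
  have h : Commute A (NormedSpace.exp (t • A)) :=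
    ((Commute.refl A).smul_right t).exp_right
  exact DFunLike.congr_fun h.eq x

variable [CompleteSpace E]

theorem hasDerivAt_exp_smul_apply (A : E →L[ℝ] E) (x : E) (t : ℝ) :
    HasDerivAt (fun s : ℝ => NormedSpace.exp (s • A) x) (A (NormedSpace.exp (t • A) x)) t := by
  have h := (hasDerivAt_exp_smul_const' (𝕂 := ℝ) A t).clm_apply (hasDerivAt_const t x)
  simpa using h

theorem norm_exp_approxGenerator_sq_le (hK : ∀ x, inner ℝ (K x) x = 0) (hε : 0 ≤ ε)
    (hP : ∀ x, K (P x) - ε • P x = x) (hP' : ∀ x, P (K x - ε • x) = x) (x : E) {t : ℝ}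
    (ht : t ∈ Icc 0 T) :
    ‖NormedSpace.exp (t • approxGenerator K π P) x‖ ^ 2
      ≤ Real.exp ((2 * ‖K ∘L π‖ + 1) * T) * ‖x‖ ^ 2 := by
  have h := energy_estimate (T := T) (β := ‖K ∘L π‖) (c := 0)
    (d := fun s => NormedSpace.exp (s • approxGenerator K π P) x)
    (fun s _ => (hasDerivAt_exp_smul_apply _ x s).continuousAt.continuousWithinAt)
    (fun s _ => hasDerivAt_exp_smul_apply _ x s)
    (fun s _ => by
      rw [zero_mul, add_zero]
      exact inner_approxGenerator_le hK hε hP hP' _) ht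
  simp only [abs_norm, zero_smul, NormedSpace.exp_zero, ne_eq, OfNat.ofNat_ne_zero,
    not_false_eq_true, zero_pow, zero_mul, add_zero, one_apply_eq_self] at h
  refine h.trans ?_
  gcongr
  exact ht.2

theorem norm_exp_approxGenerator_le (hK : ∀ x, inner ℝ (K x) x = 0) (hε : 0 ≤ ε)
    (hP : ∀ x, K (P x) - ε • P x = x) (hP' : ∀ x, P (K x - ε • x) = x) (x : E) {t : ℝ}
    (ht : t ∈ Icc 0 T) :
    ‖NormedSpace.exp (t • approxGenerator K π P) x‖
      ≤ Real.exp ((2 * ‖K ∘L π‖ + 1) * T) * ‖x‖ := by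
  have hT : 0 ≤ T := ht.1.trans ht.2
  refine le_of_sq_le_sq ((norm_exp_approxGenerator_sq_le hK hε hP hP' x ht).trans ?_)
    (by positivity)
  rw [mul_pow]
  gcongr
  exact le_self_pow₀ (Real.one_le_exp (by positivity)) two_ne_zero

/-- The difference of the two flows solves the `A`-equation with forcing `(A - B) v = (ε - δ) P w`,
`w = B v`. Since `w` is `K (B w - K π w)` up to `δ B w`, the vector `P w` stays bounded although `P`
itself is of size `1 / ε`. Hence the forcing is `O(ε)`, and the energy estimate applies. -/
theorem norm_exp_approxGenerator_sub_le (hK : ∀ x, inner ℝ (K x) x = 0) (hδ : 0 < δ) (hδε : δ ≤ ε)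
    (hP : ∀ x, K (P x) - ε • P x = x) (hP' : ∀ x, P (K x - ε • x) = x)
    (hQ : ∀ x, K (Q x) - δ • Q x = x) (hQ' : ∀ x, Q (K x - δ • x) = x) (x : E) {a b : ℝ}
    (ha : ‖approxGenerator K π Q x‖ ≤ a)
    (hb : ‖approxGenerator K π Q (approxGenerator K π Q x)‖ ≤ b) {t : ℝ} (ht : t ∈ Icc 0 T) :
    ‖NormedSpace.exp (t • approxGenerator K π P) x - NormedSpace.exp (t • approxGenerator K π Q) x‖
      ≤ ε * (Real.exp ((2 * ‖K ∘L π‖ + 1) * T) ^ 2 * (2 * b + ‖K ∘L π‖ * a) * (T + 1)) := by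
  set β := ‖K ∘L π‖ with hβ
  set M := Real.exp ((2 * β + 1) * T) with hM
  have hT : 0 ≤ T := ht.1.trans ht.2
  have hβ0 : 0 ≤ β := norm_nonneg _
  have hM1 : 1 ≤ M := Real.one_le_exp (by positivity)
  have ha0 : 0 ≤ a := (norm_nonneg _).trans ha
  have hb0 : 0 ≤ b := (norm_nonneg _).trans hb
  set A := approxGenerator K π P with hA
  set B := approxGenerator K π Q with hB
  set u : ℝ → E := fun s => NormedSpace.exp (s • A) x with hu
  set v : ℝ → E := fun s => NormedSpace.exp (s • B) x with hv
  have hd : ∀ s, HasDerivAt (fun s => u s - v s) (A (u s) - B (v s)) s := fun s =>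
    (hasDerivAt_exp_smul_apply A x s).sub (hasDerivAt_exp_smul_apply B x s)
  have hε0 : 0 ≤ ε := hδ.le.trans hδε
  have hdiff : ∀ s ∈ Icc 0 T, ‖A (v s) - B (v s)‖ ≤ ε * (M * (2 * b + β * a)) := by
    intro s hs
    set w := B (v s) with hw
    have hwa : ‖w‖ ≤ M * a := by
      rw [hw, hv, exp_smul_apply_comm]
      exact (norm_exp_approxGenerator_le hK hδ.le hQ hQ' _ hs).trans (by gcongr)
    have hwb : ‖B w‖ ≤ M * b := by
      rw [hw, hv, exp_smul_apply_comm, exp_smul_apply_comm]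
      exact (norm_exp_approxGenerator_le hK hδ.le hQ hQ' _ hs).trans (by gcongr)
    have h1 : w = K (B w - K (π w)) - δ • B w := by
      have := resolvent_approxGenerator (π := π) hQ w
      rw [map_sub, sub_right_comm, this]
      abel
    have h2 : ‖P (K (B w - K (π w)))‖ ≤ M * b + β * (M * a) :=
      (norm_resolvent_comp_le hK hP hP' _).trans <| (norm_sub_le _ _).trans <|
        add_le_add hwb <| (norm_comp_apply_le K π w).trans (by gcongr)
    have h3 := norm_mul_resolvent_le hK hP (B w)
    rw [approxGenerator_sub hP' hQ, norm_smul, Real.norm_of_nonneg (sub_nonneg.2 hδε)]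
    have h4 : ‖P w‖ ≤ ‖P (K (B w - K (π w)))‖ + δ * ‖P (B w)‖ := by
      conv_lhs => rw [h1]
      rw [map_sub, map_smul]
      refine (norm_sub_le _ _).trans ?_
      rw [norm_smul, Real.norm_of_nonneg hδ.le]
    calc (ε - δ) * ‖P w‖ ≤ ε * ‖P w‖ := by gcongr; linarith
      _ ≤ ε * (M * b + β * (M * a) + δ * ‖P (B w)‖) := by gcongr; linarith
      -- The factor `ε` is moved next to `P`, where `ε ‖P‖ ≤ 1` absorbs it; `δ ≤ ε` then restores
      -- the smallness.
      _ = ε * (M * b + β * (M * a)) + δ * (ε * ‖P (B w)‖) := by ring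
      _ ≤ ε * (M * b + β * (M * a)) + ε * (M * b) :=
        add_le_add_right (mul_le_mul hδε (h3.trans hwb) (by positivity) hε0) _
      _ = _ := by ring
  set c := ε * (M * (2 * b + β * a)) with hc
  have hc0 : 0 ≤ c := by positivity
  have key := energy_estimate (T := T) (β := β) (c := c)
    (fun s _ => (hd s).continuousAt.continuousWithinAt) (fun s _ => hd s)
    (fun s hs => by
      have h1 : A (u s) - B (v s) = A (u s - v s) + (A (v s) - B (v s)) := by
        rw [map_sub]; abel
      rw [h1, inner_add_right]
      refine add_le_add (inner_approxGenerator_le hK hε0 hP hP' _) ?_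
      refine (real_inner_le_norm _ _).trans ?_
      rw [mul_comm]
      gcongr
      exact hdiff s (Ioo_subset_Icc_self hs)) ht
  have h0 : u 0 - v 0 = 0 := by simp [hu, hv]
  rw [h0, norm_zero, abs_of_nonneg hβ0] at key
  refine le_of_sq_le_sq (key.trans ?_) (by positivity)
  have h5 : ε * (M ^ 2 * (2 * b + β * a) * (T + 1)) = M * (c * (T + 1)) := by rw [hc]; ring
  rw [h5]
  have h6 : Real.exp ((2 * β + 1) * t) ≤ M ^ 2 :=
    (Real.exp_le_exp.2 (by gcongr; exact ht.2)).trans (le_self_pow₀ hM1 two_ne_zero)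
  have h7 : 0 ^ 2 + c ^ 2 * t ≤ (c * (T + 1)) ^ 2 := by
    have : t ≤ (T + 1) ^ 2 := by nlinarith [ht.2]
    rw [mul_pow]
    nlinarith [mul_le_mul_of_nonneg_left this (sq_nonneg c)]
  calc _ ≤ M ^ 2 * (c * (T + 1)) ^ 2 :=
        mul_le_mul h6 h7 (by have := ht.1; positivity) (by positivity)
    _ = _ := by ring

theorem exists_tendstoUniformlyOn {E : Type*} [NormedAddCommGroup E] [CompleteSpace E] {s : Set ℝ} {u : ℕ → ℝ → E} {b : ℕ → ℝ}
    (hb : Filter.Tendsto b Filter.atTop (nhds 0))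
    (h : ∀ n m, n ≤ m → ∀ t ∈ s, ‖u n t - u m t‖ ≤ b n) :
    ∃ v : ℝ → E, TendstoUniformlyOn u v Filter.atTop s := by
  have hU : UniformCauchySeqOn u Filter.atTop s := by
    rw [Metric.uniformCauchySeqOn_iff]
    intro ε hε
    obtain ⟨N, hN⟩ := (Metric.tendsto_atTop.1 hb) (ε / 2) (by positivity)
    have hbN : b N < ε / 2 := by
      have := hN N le_rfl
      rw [Real.dist_0_eq_abs] at this
      exact lt_of_abs_lt this
    refine ⟨N, fun m hm n hn t ht => ?_⟩
    have h1 := h N m hm t ht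
    have h2 := h N n hn t ht
    rw [← dist_eq_norm] at h1 h2
    have := dist_triangle_left (u m t) (u n t) (u N t)
    linarith
  have hlim : ∀ t ∈ s, ∃ y, Filter.Tendsto (fun n => u n t) Filter.atTop (nhds y) :=
    fun t ht => cauchySeq_tendsto_of_complete (hU.cauchySeq ht)
  choose! v hv using hlim
  exact ⟨v, hU.tendstoUniformlyOn_of_tendsto hv⟩

end Generator

/-! ### Existence for all initial data: density and the solution operators. -/

section Existence

variable {E : Type*} [NormedAddCommGroup E] [InnerProductSpace ℝ E] [CompleteSpace E]
  {K π : E →L[ℝ] E} {T : ℝ}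

theorem inner_apply_eq_neg {E : Type*} [NormedAddCommGroup E] [InnerProductSpace ℝ E]
    {K : E →L[ℝ] E} (hK : ∀ x, inner ℝ (K x) x = 0) (x y : E) :
    inner ℝ (K x) y = -inner ℝ x (K y) := by
  have h := hK (x + y)
  rw [map_add, inner_add_left, inner_add_right, inner_add_right, hK, hK, zero_add, add_zero] at h
  rw [real_inner_comm (K y) x]
  linarith

theorem dense_of_forall_inner_eq_zero {F : Type*} [NormedAddCommGroup F] [InnerProductSpace ℝ F]
    [CompleteSpace F] {D : Submodule ℝ F} (h : ∀ y, (∀ x ∈ D, inner ℝ x y = 0) → y = 0) :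
    Dense (D : Set F) := by
  rw [Submodule.dense_iff_topologicalClosure_eq_top, Submodule.topologicalClosure_eq_top_iff,
    Submodule.eq_bot_iff]
  exact fun y hy => h y ((Submodule.mem_orthogonal _ _).1 hy)

theorem IsIntegralSolution.eqOn (hK : ∀ x, inner ℝ (K x) x = 0) (hinj : Function.Injective K)
    {c u v : ℝ → E} (hu : IsIntegralSolution K π T c u) (hv : IsIntegralSolution K π T c v) :
    EqOn u v (Icc 0 T) := by
  intro t ht
  have h := (hu.add (hv.smul (-1))).congr_data (d := fun _ => 0) (fun t _ => by simp)
  have := h.eqOn_zero hK hinj ht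
  simp only [neg_smul, one_smul, Pi.zero_apply] at this
  rwa [← sub_eq_add_neg, sub_eq_zero] at this

/-- Solvability with a bound extends from a dense subspace of data to all data. -/
theorem exists_integralSolution_of_dense (hK : ∀ x, inner ℝ (K x) x = 0)
    (hinj : Function.Injective K) {F : Type*} [NormedAddCommGroup F] [NormedSpace ℝ F]
    {D : Submodule ℝ F} (hD : Dense (D : Set F)) (Ψ : ℝ → F →L[ℝ] E) {C : ℝ} (hC : 0 ≤ C)
    (h : ∀ x ∈ D, ∃ u, IsIntegralSolution K π T (fun t => K (Ψ t x)) u ∧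
      ∀ t ∈ Icc 0 T, ‖u t‖ ≤ C * ‖x‖) (x : F) :
    ∃ u, IsIntegralSolution K π T (fun t => K (Ψ t x)) u ∧ ∀ t ∈ Icc 0 T, ‖u t‖ ≤ C * ‖x‖ := by
  have hx : ∀ n : ℕ, ∃ y ∈ D, dist x y < 1 / ((n : ℝ) + 1) := fun n =>
    Metric.mem_closure_iff.1 (hD x) _ Nat.one_div_pos_of_nat
  choose y hyD hy using hx
  choose! u hu hub using h
  have hylim : Filter.Tendsto y Filter.atTop (nhds x) := by
    rw [tendsto_iff_dist_tendsto_zero]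
    refine squeeze_zero (fun _ => dist_nonneg) (fun n => ?_)
      tendsto_one_div_add_atTop_nhds_zero_nat
    rw [dist_comm]
    exact (hy n).le
  have hlim : Filter.Tendsto (fun n : ℕ => C * (2 * (1 / ((n : ℝ) + 1)))) Filter.atTop (nhds 0) := by
    simpa using (tendsto_one_div_add_atTop_nhds_zero_nat (𝕜 := ℝ)).const_mul 2 |>.const_mul C
  obtain ⟨v, hv⟩ := exists_tendstoUniformlyOn (s := Icc 0 T) (u := fun n => u (y n)) hlim
    (fun n m hnm t ht => by
      -- The solutions are chosen datum by datum; uniqueness identifies their difference with the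
      -- one chosen for `y n - y m`, to which the bound applies.
      have h1 := (hu _ (hyD n)).add ((hu _ (hyD m)).smul (-1))
      have h2 := (hu _ (D.sub_mem (hyD n) (hyD m))).congr_data
        (d := fun t => K (Ψ t (y n)) + (-1 : ℝ) • K (Ψ t (y m)))
        (fun t _ => by simp [sub_eq_add_neg])
      have h3 := h1.eqOn hK hinj h2 ht
      simp only [neg_smul, one_smul, ← sub_eq_add_neg] at h3
      rw [h3]
      refine (hub _ (D.sub_mem (hyD n) (hyD m)) t ht).trans ?_
      gcongr
      rw [← dist_eq_norm]
      have h4 : 1 / ((m : ℝ) + 1) ≤ 1 / ((n : ℝ) + 1) := Nat.one_div_le_one_div hnm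
      linarith [dist_triangle_left (y n) (y m) x, hy n, hy m])
  refine ⟨v, IsIntegralSolution.of_tendsto (fun n => hu _ (hyD n)) hv fun t _ =>
    ((K ∘L Ψ t).continuous.tendsto x).comp hylim, fun t ht => ?_⟩
  exact le_of_tendsto_of_tendsto (hv.tendsto_at ht).norm ((hylim.norm).const_mul C)
    (Filter.Eventually.of_forall fun n => hub _ (hyD n) t ht)

/-- The datum `x = K² q` lies in the domain of the square of the generator, which sends it to `K r`.
Therefore the approximate generators and their squares, applied to `x`, are bounded uniformly in
`ε`, and the exponentials are uniformly Cauchy. -/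
theorem exists_integralSolution_of_range (hK : ∀ x, inner ℝ (K x) x = 0) (q : E) :
    ∃ u, IsIntegralSolution K π T (fun _ => K (K (K q))) u ∧
      ∀ t ∈ Icc 0 T, ‖u t‖ ≤ Real.exp ((2 * ‖K ∘L π‖ + 1) * T) * ‖K (K q)‖ := by
  set x := K (K q) with hx
  have hpos : ∀ n : ℕ, (0 : ℝ) < 1 / ((n : ℝ) + 1) := fun n => Nat.one_div_pos_of_nat
  choose P hP hP' using fun n => exists_resolvent K hK (hpos n)
  set r := q + π x with hr
  have hAx : ∀ n, approxGenerator K π (P n) x = P n (K (K r)) := by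
    intro n
    rw [approxGenerator_apply, hr]
    simp only [map_add]
    rw [hx]
  have ha : ∀ n, ‖approxGenerator K π (P n) x‖ ≤ ‖K r‖ := fun n => by
    rw [hAx]
    exact norm_resolvent_comp_le hK (hP n) (hP' n) _
  have hb : ∀ n, ‖approxGenerator K π (P n) (approxGenerator K π (P n) x)‖
      ≤ ‖r‖ + ‖K ∘L π‖ * ‖K r‖ := by
    intro n
    rw [approxGenerator_apply, map_add]
    refine (norm_add_le _ _).trans (add_le_add ?_ ?_)
    · rw [hAx, resolvent_comm (hP n) (hP' n)]
      refine (norm_resolvent_comp_le hK (hP n) (hP' n) _).trans ?_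
      exact norm_resolvent_comp_le hK (hP n) (hP' n) _
    · refine (norm_resolvent_comp_le hK (hP n) (hP' n) _).trans ?_
      refine (norm_comp_apply_le K π _).trans ?_
      gcongr
      exact ha n
  set u : ℕ → ℝ → E := fun n t => NormedSpace.exp (t • approxGenerator K π (P n)) x with hu
  have hlim := (tendsto_one_div_add_atTop_nhds_zero_nat (𝕜 := ℝ)).mul_const
    (Real.exp ((2 * ‖K ∘L π‖ + 1) * T) ^ 2 *
      (2 * (‖r‖ + ‖K ∘L π‖ * ‖K r‖) + ‖K ∘L π‖ * ‖K r‖) * (T + 1))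
  rw [zero_mul] at hlim
  obtain ⟨v, hv⟩ := exists_tendstoUniformlyOn (s := Icc 0 T) (u := u) hlim
    (fun n m hnm t ht => norm_exp_approxGenerator_sub_le hK (hpos m)
      (Nat.one_div_le_one_div hnm) (hP n) (hP' n) (hP m) (hP' m) x (ha m) (hb m) ht)
  have hub : ∀ n, ∀ t ∈ Icc 0 T, ‖u n t‖ ≤ Real.exp ((2 * ‖K ∘L π‖ + 1) * T) * ‖x‖ :=
    fun n t ht => norm_exp_approxGenerator_le hK (hpos n).le (hP n) (hP' n) x ht
  have hder : ∀ n t, HasDerivAt (u n) (approxGenerator K π (P n) (u n t)) t :=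
    fun n t => hasDerivAt_exp_smul_apply _ x t
  have hcont : ∀ n, Continuous (u n) := fun n =>
    continuous_iff_continuousAt.2 fun t => (hder n t).continuousAt
  -- Each exponential solves the limit equation exactly, with data perturbed by `ε (u n t - x)`.
  have hsol : ∀ n : ℕ, IsIntegralSolution K π T
      (fun t => K x + (1 / ((n : ℝ) + 1)) • (u n t - x)) (u n) := by
    intro n
    refine ⟨(hcont n).continuousOn, fun t ht => ?_⟩
    have h1 : ∀ s ∈ uIcc 0 t, HasDerivAt (fun s => K (u n s) - (1 / ((n : ℝ) + 1)) • u n s)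
        (u n s + K (K (π (u n s)))) s := by
      intro s _
      rw [← resolvent_approxGenerator (hP n)]
      exact (K.hasFDerivAt.comp_hasDerivAt s (hder n s)).sub ((hder n s).const_smul _)
    have hi : Continuous fun s => u n s + K (K (π (u n s))) :=
      (hcont n).add ((K ∘L K ∘L π).continuous.comp (hcont n))
    rw [intervalIntegral.integral_eq_sub_of_hasDerivAt h1 (hi.intervalIntegrable _ _)]
    have h0 : u n 0 = x := by simp [hu]
    rw [h0, smul_sub]
    abel
  refine ⟨v, IsIntegralSolution.of_tendsto hsol hv fun t ht => ?_, fun t ht => ?_⟩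
  · have h1 := (tendsto_one_div_add_atTop_nhds_zero_nat (𝕜 := ℝ)).smul
      ((hv.tendsto_at ht).sub_const x)
    rw [zero_smul] at h1
    simpa using h1.const_add (K x)
  · exact le_of_tendsto (hv.tendsto_at ht).norm
      (Filter.Eventually.of_forall fun n => hub n t ht)

/-- Linearity in the datum comes from uniqueness. Outside `[0,T]` the operators are set to `0`; no
semigroup law is needed. -/
theorem exists_semigroup (hK : ∀ x, inner ℝ (K x) x = 0) (hinj : Function.Injective K)
    (T : ℝ) : ∃ (S : ℝ → E →L[ℝ] E) (M : ℝ), 0 ≤ M ∧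
      (∀ x, IsIntegralSolution K π T (fun _ => K x) (fun t => S t x)) ∧
      ∀ t ∈ Icc 0 T, ∀ x, ‖S t x‖ ≤ M * ‖x‖ := by
  set M := Real.exp ((2 * ‖K ∘L π‖ + 1) * T) with hM
  have hD : Dense (LinearMap.range ((K ∘L K : E →L[ℝ] E) : E →ₗ[ℝ] E) : Set E) := by
    refine dense_of_forall_inner_eq_zero fun y hy => ?_
    -- Testing against `K² (K² y)` gives `‖K² y‖² = 0` by skewness.
    have h := hy _ ⟨K (K y), rfl⟩
    simp only [ContinuousLinearMap.coe_coe, ContinuousLinearMap.comp_apply] at h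
    rw [inner_apply_eq_neg hK, inner_apply_eq_neg hK, neg_neg, inner_self_eq_zero] at h
    exact hinj ((hinj (h.trans (map_zero K).symm)).trans (map_zero K).symm)
  have hex := exists_integralSolution_of_dense (T := T) (π := π) hK hinj hD
    (fun _ => ContinuousLinearMap.id ℝ E) (C := M) (Real.exp_pos _).le (by
      rintro _ ⟨q, rfl⟩
      exact exists_integralSolution_of_range hK q)
  choose u hu hub using hex
  have hadd : ∀ x y, ∀ t ∈ Icc 0 T, u (x + y) t = u x t + u y t := fun x y =>
    (hu (x + y)).eqOn hK hinj (((hu x).add (hu y)).congr_data fun t _ => by simp)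
  have hsmul : ∀ (a : ℝ) x, ∀ t ∈ Icc 0 T, u (a • x) t = a • u x t := fun a x =>
    (hu (a • x)).eqOn hK hinj (((hu x).smul a).congr_data fun t _ => by simp)
  have hS : ∀ t : ℝ, ∃ S : E →L[ℝ] E, t ∈ Icc 0 T → ∀ x, S x = u x t := by
    intro t
    by_cases ht : t ∈ Icc 0 T
    · exact ⟨LinearMap.mkContinuous
        { toFun := fun x => u x t
          map_add' := fun x y => hadd x y t ht
          map_smul' := fun a x => hsmul a x t ht } M fun x => hub x t ht, fun _ _ => rfl⟩
    · exact ⟨0, fun h => absurd h ht⟩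
  choose S hS using hS
  refine ⟨S, M, (Real.exp_pos _).le, fun x => (hu x).congr fun t ht => (hS t ht x).symm,
    fun t ht x => ?_⟩
  rw [hS t ht]
  exact hub x t ht

end Existence

/-! ### Sources that are step functions in time, and the Duhamel bound. -/

section Sources

variable {E : Type*} [NormedAddCommGroup E] [InnerProductSpace ℝ E]
  {K π : E →L[ℝ] E} {T : ℝ}

theorem integral_ite_shift {E : Type*} [NormedAddCommGroup E] [NormedSpace ℝ E]
    {a t : ℝ} (ha : 0 ≤ a) {g : ℝ → E}
    (hg : ContinuousOn g (Icc 0 t)) :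
    (IntervalIntegrable (fun s => if a < s then g (s - a) else 0) volume 0 t) ∧
    ∫ s in (0 : ℝ)..t, (if a < s then g (s - a) else 0) = ∫ s in (0 : ℝ)..max (t - a) 0, g s := by
  have hz : ∀ b, b ≤ a → EqOn (fun s => if a < s then g (s - a) else 0) (fun _ => 0) (uIoc 0 b) := by
    intro b hb s hs
    have : s ≤ a := by
      rcases le_total 0 b with h | h
      · rw [uIoc_of_le h] at hs; exact hs.2.trans hb
      · rw [uIoc_of_ge h] at hs; exact hs.2.trans ha
    simp [not_lt.2 this]
  have hzi : ∀ b, b ≤ a →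
      IntervalIntegrable (fun s => if a < s then g (s - a) else 0) volume 0 b := fun b hb =>
    (intervalIntegrable_congr (hz b hb)).2 intervalIntegrable_const
  have hz0 : ∀ b, b ≤ a → ∫ s in (0 : ℝ)..b, (if a < s then g (s - a) else 0) = 0 := by
    intro b hb
    rw [intervalIntegral.integral_congr_ae (Filter.Eventually.of_forall (hz b hb))]
    simp
  rcases le_total t a with hta | hta
  · rw [max_eq_right (by linarith), intervalIntegral.integral_same]
    exact ⟨hzi t hta, hz0 t hta⟩
  · rw [max_eq_left (by linarith)]
    have h1 : EqOn (fun s => if a < s then g (s - a) else 0) (fun s => g (s - a)) (uIoc a t) := by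
      intro s hs
      rw [uIoc_of_le hta] at hs
      simp [hs.1]
    have h2 : IntervalIntegrable (fun s => g (s - a)) volume a t := by
      apply ContinuousOn.intervalIntegrable
      rw [uIcc_of_le hta]
      exact hg.comp (by fun_prop) fun s hs => ⟨by linarith [hs.1], by linarith [hs.2]⟩
    have h3 := (intervalIntegrable_congr (μ := volume) h1).2 h2
    refine ⟨(hzi a le_rfl).trans h3, ?_⟩
    rw [← intervalIntegral.integral_add_adjacent_intervals (hzi a le_rfl) h3, hz0 a le_rfl,
      zero_add, intervalIntegral.integral_congr_ae (Filter.Eventually.of_forall h1),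
      intervalIntegral.integral_comp_sub_right (fun s => g s) a, sub_self]

/-- A solution starting at `0` may be kept at rest until time `a` and then run; `max (t - a) 0`
encodes this delay. -/
theorem IsIntegralSolution.shift {h : E} {v : ℝ → E} {a : ℝ} (ha : 0 ≤ a)
    (hv : IsIntegralSolution K π T (fun t => t • K h) v) (h0 : v 0 = 0) :
    IsIntegralSolution K π T (fun t => max (t - a) 0 • K h) (fun t => v (max (t - a) 0)) := by
  have hm : MapsTo (fun t => max (t - a) 0) (Icc 0 T) (Icc 0 T) := fun t ht =>
    ⟨le_max_right _ _, max_le (by linarith [ht.2]) (ht.1.trans ht.2)⟩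
  refine ⟨hv.continuousOn.comp (by fun_prop) hm, fun t ht => ?_⟩
  rw [hv.eq _ (hm ht), ← (integral_ite_shift ha
    (hv.continuousOn_integrand.mono (Icc_subset_Icc_right ht.2))).2]
  congr 1
  refine intervalIntegral.integral_congr fun s _ => ?_
  split_ifs with hs
  · rw [max_eq_left (by linarith)]
  · rw [max_eq_right (by linarith), h0]
    simp

variable [CompleteSpace E]

/-- The equation is autonomous, so integrating in time turns the initial value `h` into the constant
source `h`. -/
theorem IsIntegralSolution.primitive {h : E} {u : ℝ → E}
    (hu : IsIntegralSolution K π T (fun _ => K h) u) :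
    IsIntegralSolution K π T (fun t => t • K h) (fun t => ∫ s in (0 : ℝ)..t, u s) := by
  rcases lt_or_ge T 0 with hT | hT
  · constructor <;> simp [Icc_eq_empty (not_le.2 hT)]
  refine ⟨?_, fun t ht => ?_⟩
  · have := intervalIntegral.continuousOn_primitive_interval' (μ := volume) (a := 0)
      (intervalIntegrable_of_continuousOn_Icc (right_mem_Icc.2 hT) hu.continuousOn) left_mem_uIcc
    rwa [uIcc_of_le hT] at this
  have hsub : ∀ s ∈ uIcc 0 t, s ∈ Icc 0 T := fun s hs => by
    rw [uIcc_of_le ht.1] at hs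
    exact Icc_subset_Icc_right ht.2 hs
  have hN : ∀ s ∈ uIcc 0 t, (∫ r in (0 : ℝ)..s, u r) + K (K (π (∫ r in (0 : ℝ)..s, u r)))
      = K (u s) - K h := by
    intro s hs
    have hi := intervalIntegrable_of_continuousOn_Icc (hsub s hs) hu.continuousOn
    have h2 := (K ∘L K ∘L π).intervalIntegral_comp_comm hi
    have h1 := intervalIntegral.integral_add hi
      (intervalIntegrable_of_continuousOn_Icc (hsub s hs)
        ((K ∘L K ∘L π).continuous.comp_continuousOn hu.continuousOn))
    rw [hu.eq s (hsub s hs), add_sub_cancel_left]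
    exact (h1.trans (congrArg _ h2)).symm
  have hKu : IntervalIntegrable (fun s => K (u s)) volume 0 t :=
    intervalIntegrable_of_continuousOn_Icc ht (K.continuous.comp_continuousOn hu.continuousOn)
  rw [intervalIntegral.integral_congr hN, intervalIntegral.integral_sub hKu
    intervalIntegrable_const, intervalIntegral.integral_const, sub_zero, add_sub_cancel]
  exact (K.intervalIntegral_comp_comm
    (intervalIntegrable_of_continuousOn_Icc ht hu.continuousOn)).symm

theorem intervalIntegrable_finsetSum {ι F : Type*} [NormedAddCommGroup F] (s : Finset ι)
    {f : ι → ℝ → F} {a b : ℝ} (hf : ∀ i ∈ s, IntervalIntegrable (f i) volume a b) :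
    IntervalIntegrable (fun r => ∑ i ∈ s, f i r) volume a b := by
  simpa only [← Finset.sum_apply] using IntervalIntegrable.sum s hf

/-- `σ a h` stands for the source equal to `h` on `(a,T)` and `0` before; `hσ` prescribes the L²
Gram matrix of such steps. Hence the norm in `𝒲` is the L² norm of the step function, and
Cauchy–Schwarz compares it with the L¹ norm. -/
theorem sq_integral_norm_sum_step_le {ι X 𝒲 : Type*} [NormedAddCommGroup X] [InnerProductSpace ℝ X]
    [NormedAddCommGroup 𝒲] [InnerProductSpace ℝ 𝒲] {σ : ℝ → X →L[ℝ] 𝒲}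
    (hσ : ∀ a ∈ Icc 0 T, ∀ b ∈ Icc 0 T, ∀ h k : X,
      inner ℝ (σ a h) (σ b k) = (T - max a b) * inner ℝ h k)
    (hT : 0 ≤ T) (s : Finset ι) (a : ι → ℝ) (ha : ∀ i ∈ s, a i ∈ Icc 0 T) (h : ι → X) :
    IntervalIntegrable (fun r => ∑ i ∈ s, if a i < r then h i else 0) volume 0 T ∧
    (∫ r in (0 : ℝ)..T, ‖∑ i ∈ s, if a i < r then h i else 0‖) ^ 2
      ≤ T * ‖∑ i ∈ s, σ (a i) (h i)‖ ^ 2 := by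
  have hi : IntervalIntegrable (fun r => ∑ i ∈ s, if a i < r then h i else 0) volume 0 T :=
    intervalIntegrable_finsetSum s fun i hi =>
      (integral_ite_shift (g := fun _ => h i) (ha i hi).1 continuousOn_const).1
  refine ⟨hi, ?_⟩
  set f : ℝ → X := fun r => ∑ i ∈ s, if a i < r then h i else 0 with hf
  have hsq : ∀ r, ‖f r‖ ^ 2 = ∑ i ∈ s, ∑ j ∈ s,
      (if max (a i) (a j) < r then inner ℝ (h i) (h j) else 0) := by
    intro r
    rw [← real_inner_self_eq_norm_sq, hf]
    simp only [sum_inner, inner_sum]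
    rw [Finset.sum_comm]
    refine Finset.sum_congr rfl fun i _ => Finset.sum_congr rfl fun j _ => ?_
    by_cases h1 : a i < r <;> by_cases h2 : a j < r <;> simp [h1, h2]
  have hstep : ∀ b ∈ Icc 0 T, ∀ c : ℝ,
      IntervalIntegrable (fun r => if b < r then c else 0) volume 0 T ∧
      ∫ r in (0 : ℝ)..T, (if b < r then c else 0) = (T - b) * c := by
    intro b hb c
    have := integral_ite_shift (t := T) (g := fun _ => c) hb.1 continuousOn_const
    rwa [intervalIntegral.integral_const, smul_eq_mul, sub_zero,
      max_eq_left (by linarith [hb.2])] at this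
  have hmax : ∀ i ∈ s, ∀ j ∈ s, max (a i) (a j) ∈ Icc 0 T := fun i hi j hj =>
    ⟨le_max_of_le_left (ha i hi).1, max_le (ha i hi).2 (ha j hj).2⟩
  have hsqi : IntervalIntegrable (fun r => ‖f r‖ ^ 2) volume 0 T := by
    simp only [hsq]
    exact intervalIntegrable_finsetSum s fun i hi => intervalIntegrable_finsetSum s fun j hj => (hstep _ (hmax i hi j hj) _).1
  have hI : ∫ r in (0 : ℝ)..T, ‖f r‖ ^ 2 = ‖∑ i ∈ s, σ (a i) (h i)‖ ^ 2 := by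
    rw [← real_inner_self_eq_norm_sq]
    simp only [hsq, sum_inner, inner_sum]
    rw [Finset.sum_comm, intervalIntegral.integral_finsetSum]
    · refine Finset.sum_congr rfl fun i hi => ?_
      rw [intervalIntegral.integral_finsetSum fun j hj => (hstep _ (hmax i hi j hj) _).1]
      refine Finset.sum_congr rfl fun j hj => ?_
      rw [(hstep _ (hmax i hi j hj) _).2, hσ _ (ha i hi) _ (ha j hj)]
    · exact fun i hi => intervalIntegrable_finsetSum s fun j hj => (hstep _ (hmax i hi j hj) _).1
  rw [← hI]
  rcases hT.eq_or_lt with rfl | hT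
  · simp
  set y := ∫ r in (0 : ℝ)..T, ‖f r‖ with hy
  -- Cauchy–Schwarz as the nonnegativity of a variance, `y / T` being the mean of `‖f‖`.
  have h1 : 0 ≤ ∫ r in (0 : ℝ)..T, (‖f r‖ - y / T) ^ 2 :=
    intervalIntegral.integral_nonneg hT.le fun _ _ => sq_nonneg _
  have h2 : ∫ r in (0 : ℝ)..T, (‖f r‖ - y / T) ^ 2
      = (∫ r in (0 : ℝ)..T, ‖f r‖ ^ 2) - (2 * (y / T)) * y + T * (y / T) ^ 2 := by
    have : ∀ r, (‖f r‖ - y / T) ^ 2 = ‖f r‖ ^ 2 - (2 * (y / T)) * ‖f r‖ + (y / T) ^ 2 :=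
      fun r => by ring
    simp only [this]
    rw [intervalIntegral.integral_add (hsqi.sub (hi.norm.const_mul _)) intervalIntegrable_const,
      intervalIntegral.integral_sub hsqi (hi.norm.const_mul _),
      intervalIntegral.integral_const_mul, intervalIntegral.integral_const, ← hy, sub_zero,
      smul_eq_mul]
  rw [h2] at h1
  have h3 : (2 * (y / T)) * y - T * (y / T) ^ 2 = y ^ 2 / T := by field_simp; ring
  have h4 : y ^ 2 / T ≤ ∫ r in (0 : ℝ)..T, ‖f r‖ ^ 2 := by linarith
  rw [div_le_iff₀ hT] at h4
  linarith

/-- The source space enters only through its step elements: their Gram matrix, their time integrals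
and their totality. The constant `M ‖j‖ √T` does not depend on the number of steps, so solvability
passes to the closure. -/
theorem exists_integralSolution_source (hK : ∀ x, inner ℝ (K x) x = 0)
    (hinj : Function.Injective K) (hT : 0 ≤ T) {X 𝒲 : Type*} [NormedAddCommGroup X]
    [InnerProductSpace ℝ X] [NormedAddCommGroup 𝒲] [InnerProductSpace ℝ 𝒲] [CompleteSpace 𝒲]
    (j : X →L[ℝ] E) {σ : ℝ → X →L[ℝ] 𝒲} {Φ : ℝ → 𝒲 →L[ℝ] E}
    (hσ : ∀ a ∈ Icc 0 T, ∀ b ∈ Icc 0 T, ∀ h k : X,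
      inner ℝ (σ a h) (σ b k) = (T - max a b) * inner ℝ h k)
    (hΦ : ∀ t ∈ Icc 0 T, ∀ a ∈ Icc 0 T, ∀ h, Φ t (σ a h) = max (t - a) 0 • j h)
    (hdense : ∀ W, (∀ a ∈ Icc 0 T, ∀ h, inner ℝ (σ a h) W = 0) → W = 0) :
    ∃ C, 0 ≤ C ∧ ∀ W, ∃ u, IsIntegralSolution K π T (fun t => K (Φ t W)) u ∧
      ∀ t ∈ Icc 0 T, ‖u t‖ ≤ C * ‖W‖ := by
  obtain ⟨S, M, hM, hS, hSb⟩ := exists_semigroup (π := π) hK hinj T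
  set v : Icc 0 T × X → 𝒲 := fun p => σ p.1 p.2 with hv
  have hD : Dense (Submodule.span ℝ (range v) : Set 𝒲) :=
    dense_of_forall_inner_eq_zero fun W hW => hdense W fun a ha h =>
      hW _ (Submodule.subset_span ⟨(⟨a, ha⟩, h), rfl⟩)
  refine ⟨M * ‖j‖ * √T, by positivity, exists_integralSolution_of_dense hK hinj hD Φ
    (by positivity) fun W hW => ?_⟩
  obtain ⟨c, rfl⟩ := (Finsupp.mem_span_range_iff_exists_finsupp).1 hW
  set a : Icc 0 T × X → ℝ := fun p => p.1 with ha
  have hmem : ∀ p, a p ∈ Icc 0 T := fun p => p.1.2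
  set h : Icc 0 T × X → X := fun p => c p • p.2 with hh
  have hWsum : (c.sum fun i r => r • v i) = ∑ p ∈ c.support, σ (a p) (h p) := by
    refine Finset.sum_congr rfl fun p _ => ?_
    rw [hh, map_smul]
  rw [hWsum]
  have hsol : ∀ p, IsIntegralSolution K π T (fun t => max (t - a p) 0 • K (j (h p)))
      (fun t => ∫ s in (0 : ℝ)..max (t - a p) 0, S s (j (h p))) := fun p =>
    (hS (j (h p))).primitive.shift (hmem p).1 intervalIntegral.integral_same
  refine ⟨_, (IsIntegralSolution.sum c.support fun p _ => hsol p).congr_data fun t ht => ?_,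
    fun t ht => ?_⟩
  · simp only [map_sum, hΦ t ht _ (hmem _), map_smul]
  obtain ⟨hi, hsq⟩ := sq_integral_norm_sum_step_le hσ hT c.support a (fun p _ => hmem p) h
  set f : ℝ → X := fun r => ∑ p ∈ c.support, if a p < r then h p else 0 with hf
  have hm : ∀ s ∈ Icc 0 t, max (t - s) 0 ∈ Icc 0 T := fun s hs =>
    ⟨le_max_right _ _, max_le (by linarith [hs.1, ht.2]) hT⟩
  have hterm : ∀ p, IntervalIntegrable
      (fun s => if a p < s then S (max (t - s) 0) (j (h p)) else 0) volume 0 t ∧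
      ∫ s in (0 : ℝ)..t, (if a p < s then S (max (t - s) 0) (j (h p)) else 0)
        = ∫ s in (0 : ℝ)..max (t - a p) 0, S s (j (h p)) := by
    intro p
    have h1 := integral_ite_shift (t := t) (g := fun r => S (max (t - a p - r) 0) (j (h p))) (hmem p).1
      ((hS (j (h p))).continuousOn.comp (by fun_prop) fun r hr =>
        ⟨le_max_right _ _, max_le (by linarith [hr.1, ht.2, (hmem p).1]) hT⟩)
    simp only [sub_sub, add_sub_cancel] at h1
    refine ⟨h1.1, h1.2.trans ?_⟩
    rcases le_total t (a p) with hta | hta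
    · rw [max_eq_right (by linarith)]
      simp
    · rw [max_eq_left (by linarith)]
      have h2 := intervalIntegral.integral_comp_sub_left (a := 0) (b := t - a p)
        (fun s => S s (j (h p))) (t - a p)
      rw [sub_self, sub_zero] at h2
      rw [← h2]
      refine intervalIntegral.integral_congr fun s hs => ?_
      rw [uIcc_of_le (by linarith)] at hs
      rw [max_eq_left (by linarith [hs.2]), sub_sub]
  -- Estimating the summands separately would not give the norm of the sum. The Duhamel integral
  -- collects them first into the single step function `f`.
  have heq : ∑ p ∈ c.support, ∫ s in (0 : ℝ)..max (t - a p) 0, S s (j (h p))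
      = ∫ s in (0 : ℝ)..t, S (max (t - s) 0) (j (f s)) := by
    rw [Finset.sum_congr rfl fun p _ => (hterm p).2.symm,
      ← intervalIntegral.integral_finsetSum fun p _ => (hterm p).1]
    refine intervalIntegral.integral_congr fun s _ => ?_
    simp only [hf, map_sum]
    refine Finset.sum_congr rfl fun p _ => ?_
    split_ifs <;> simp
  have hit : IntervalIntegrable f volume 0 t := hi.mono_set (by
    rw [uIcc_of_le ht.1, uIcc_of_le hT]
    exact Icc_subset_Icc_right ht.2)
  have hy : ∫ r in (0 : ℝ)..T, ‖f r‖ ≤ √T * ‖∑ p ∈ c.support, σ (a p) (h p)‖ := by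
    refine le_of_sq_le_sq (hsq.trans_eq ?_) (by positivity)
    rw [mul_pow, Real.sq_sqrt hT]
  rw [heq]
  calc _ ≤ ∫ s in (0 : ℝ)..t, M * (‖j‖ * ‖f s‖) := by
        refine intervalIntegral.norm_integral_le_of_norm_le ht.1 (Filter.Eventually.of_forall
          fun s hs => ?_) ((hit.norm.const_mul _).const_mul _)
        exact (hSb _ (hm s (Ioc_subset_Icc_self hs)) _).trans (by gcongr; exact j.le_opNorm _)
    _ = M * ‖j‖ * ∫ s in (0 : ℝ)..t, ‖f s‖ := by
        rw [intervalIntegral.integral_const_mul, intervalIntegral.integral_const_mul, mul_assoc]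
    _ ≤ M * ‖j‖ * ∫ s in (0 : ℝ)..T, ‖f s‖ := by
        gcongr
        exact intervalIntegral.integral_mono_interval le_rfl ht.1 ht.2
          (Filter.Eventually.of_forall fun _ => norm_nonneg _) hi.norm
    _ ≤ M * ‖j‖ * (√T * _) := by gcongr
    _ = _ := by ring

end Sources

/-! ### Second-order equations as first-order systems on `V × H`. -/

section SecondOrder

variable {V H : Type*} [NormedAddCommGroup V] [InnerProductSpace ℝ V]
  [NormedAddCommGroup H] [InnerProductSpace ℝ H]

/-- The inverse `(y, z) ↦ (-R z, J y)` of the operator `(y, z) ↦ (J⁻¹ z, -R⁻¹ y)` on `V × H`. -/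
def skew (J : V →L[ℝ] H) (R : H →L[ℝ] V) : WithLp 2 (V × H) →L[ℝ] WithLp 2 (V × H) :=
  (WithLp.prodContinuousLinearEquiv 2 ℝ V H).symm.toContinuousLinearMap ∘L
    ((-(R ∘L WithLp.sndL 2 ℝ V H)).prod (J ∘L WithLp.fstL 2 ℝ V H))

theorem skew_apply (J : V →L[ℝ] H) (R : H →L[ℝ] V) (x : WithLp 2 (V × H)) :
    skew J R x = WithLp.toLp 2 (-R x.snd, J x.fst) := rfl

/-- The projection `(y, z) ↦ (y, 0)`. -/
def projFst (V H : Type*) [NormedAddCommGroup V] [InnerProductSpace ℝ V]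
    [NormedAddCommGroup H] [InnerProductSpace ℝ H] : WithLp 2 (V × H) →L[ℝ] WithLp 2 (V × H) :=
  (WithLp.prodContinuousLinearEquiv 2 ℝ V H).symm.toContinuousLinearMap ∘L
    ((WithLp.fstL 2 ℝ V H).prod 0)

/-- The inclusion `z ↦ (0, z)`. -/
def inSnd (V H : Type*) [NormedAddCommGroup V] [InnerProductSpace ℝ V]
    [NormedAddCommGroup H] [InnerProductSpace ℝ H] : H →L[ℝ] WithLp 2 (V × H) :=
  (WithLp.prodContinuousLinearEquiv 2 ℝ V H).symm.toContinuousLinearMap ∘L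
    ContinuousLinearMap.inr ℝ V H

variable {J : V →L[ℝ] H} {R : H →L[ℝ] V}

theorem inner_skew_self (hR : ∀ z y, inner ℝ (R z) y = inner ℝ z (J y)) (x : WithLp 2 (V × H)) :
    inner ℝ (skew J R x) x = 0 := by
  have h : inner ℝ (skew J R x) x = inner ℝ (-R x.snd) x.fst + inner ℝ (J x.fst) x.snd := rfl
  rw [h, inner_neg_left, hR, real_inner_comm x.snd]
  ring

theorem skew_injective (hJ : Function.Injective J) (hR : Function.Injective R) :
    Function.Injective (skew J R) := by
  rw [injective_iff_map_eq_zero]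
  intro x hx
  rw [skew_apply] at hx
  have h := congrArg WithLp.ofLp hx
  have h1 : -R x.snd = 0 := congrArg Prod.fst h
  have h2 : J x.fst = 0 := congrArg Prod.snd h
  apply WithLp.ofLp_injective
  refine Prod.ext (hJ (h2.trans (map_zero _).symm)) (hR ?_)
  exact (neg_eq_zero.1 h1).trans (map_zero _).symm

/-- Weak form of `J y' = z`, `z' = (1 - R⁻¹) y + φ'` integrated in time, `y 0 = y₀`,
where `φ 0` is the initial value of `z`. -/
structure IsSecondOrderSolution (J : V →L[ℝ] H) (R : H →L[ℝ] V) (T : ℝ) (y₀ : V) (φ : ℝ → H)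
    (y : ℝ → V) (z : ℝ → H) : Prop where
  continuousOn_fst : ContinuousOn y (Icc 0 T)
  continuousOn_snd : ContinuousOn z (Icc 0 T)
  fst_eq : ∀ t ∈ Icc 0 T, J (y t) = J y₀ + ∫ s in (0 : ℝ)..t, z s
  snd_eq : ∀ t ∈ Icc 0 T,
    ∫ s in (0 : ℝ)..t, y s = R ((∫ s in (0 : ℝ)..t, J (y s)) - (z t - φ t))

variable [CompleteSpace V] [CompleteSpace H]

/-- Read componentwise: the second component is the integrated `J y' = z`, the first is the
integrated equation for `z` multiplied by `R`. The term `K² π (y, z) = (-R J y, 0)` accounts for the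
`1` in `1 - R⁻¹`. -/
theorem isIntegralSolution_iff {T : ℝ} {y₀ : V} {φ : ℝ → H} {u : ℝ → WithLp 2 (V × H)} :
    IsIntegralSolution (skew J R) (projFst V H) T
        (fun t => skew J R (WithLp.toLp 2 (y₀, φ t))) u ↔
      IsSecondOrderSolution J R T y₀ φ (fun t => (u t).fst) (fun t => (u t).snd) := by
  have hcont : ContinuousOn u (Icc 0 T) ↔
      ContinuousOn (fun t => (u t).fst) (Icc 0 T) ∧ ContinuousOn (fun t => (u t).snd) (Icc 0 T) :=
    ⟨fun h => ⟨(WithLp.fstL 2 ℝ V H).continuous.comp_continuousOn h,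
      (WithLp.sndL 2 ℝ V H).continuous.comp_continuousOn h⟩,
     fun h => (WithLp.prodContinuousLinearEquiv 2 ℝ V H).symm.continuous.comp_continuousOn
      (h.1.prodMk h.2)⟩
  have heq : ContinuousOn u (Icc 0 T) → ∀ t ∈ Icc 0 T,
      (skew J R (u t) = skew J R (WithLp.toLp 2 (y₀, φ t)) +
        ∫ s in (0 : ℝ)..t, (u s + skew J R (skew J R (projFst V H (u s))))) ↔
      (J (u t).fst = J y₀ + ∫ s in (0 : ℝ)..t, (u s).snd) ∧
      ∫ s in (0 : ℝ)..t, (u s).fst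
        = R ((∫ s in (0 : ℝ)..t, J (u s).fst) - ((u t).snd - φ t)) := by
    intro hu t ht
    obtain ⟨h1, h2⟩ := hcont.1 hu
    have hint := intervalIntegrable_of_continuousOn_Icc ht (hu.add
      ((skew J R ∘L skew J R ∘L projFst V H).continuous.comp_continuousOn hu))
    have hi1 := intervalIntegrable_of_continuousOn_Icc ht h1
    have hi3 : IntervalIntegrable (fun s => J (u s).fst) volume 0 t :=
      intervalIntegrable_of_continuousOn_Icc ht (J.continuous.comp_continuousOn h1)
    have hi4 : IntervalIntegrable (fun s => R (J (u s).fst)) volume 0 t :=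
      intervalIntegrable_of_continuousOn_Icc ht ((R ∘L J).continuous.comp_continuousOn h1)
    have hI1 : (∫ s in (0 : ℝ)..t, (u s + skew J R (skew J R (projFst V H (u s))))).fst
        = (∫ s in (0 : ℝ)..t, (u s).fst) - R (∫ s in (0 : ℝ)..t, J (u s).fst) := by
      rw [← R.intervalIntegral_comp_comm hi3, ← intervalIntegral.integral_sub hi1 hi4]
      refine ((WithLp.fstL 2 ℝ V H).intervalIntegral_comp_comm hint).symm.trans ?_
      refine intervalIntegral.integral_congr fun s _ => ?_
      show (u s).fst + -R (J (u s).fst) = _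
      rw [sub_eq_add_neg]
    have hI2 : (∫ s in (0 : ℝ)..t, (u s + skew J R (skew J R (projFst V H (u s))))).snd
        = ∫ s in (0 : ℝ)..t, (u s).snd := by
      refine ((WithLp.sndL 2 ℝ V H).intervalIntegral_comp_comm hint).symm.trans ?_
      refine intervalIntegral.integral_congr fun s _ => ?_
      show (u s).snd + J (-R 0) = _
      simp
    rw [← (WithLp.ofLp_injective 2).eq_iff, Prod.ext_iff]
    have e1 : (WithLp.ofLp (skew J R (u t))).1 = -R (u t).snd := rfl
    have e2 : (WithLp.ofLp (skew J R (u t))).2 = J (u t).fst := rfl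
    have e3 : (WithLp.ofLp (skew J R (WithLp.toLp 2 (y₀, φ t)) +
        ∫ s in (0 : ℝ)..t, (u s + skew J R (skew J R (projFst V H (u s)))))).1
        = -R (φ t) + ((∫ s in (0 : ℝ)..t, (u s).fst) - R (∫ s in (0 : ℝ)..t, J (u s).fst)) := by
      rw [← hI1]; rfl
    have e4 : (WithLp.ofLp (skew J R (WithLp.toLp 2 (y₀, φ t)) +
        ∫ s in (0 : ℝ)..t, (u s + skew J R (skew J R (projFst V H (u s)))))).2
        = J y₀ + ∫ s in (0 : ℝ)..t, (u s).snd := by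
      rw [← hI2]; rfl
    rw [e1, e2, e3, e4, and_comm]
    refine and_congr_right fun _ => ?_
    rw [map_sub, map_sub]
    constructor <;> intro h
    · rw [neg_eq_iff_eq_neg] at h
      rw [h]; abel
    · rw [h]; abel
  constructor
  · rintro ⟨h1, h2⟩
    exact ⟨(hcont.1 h1).1, (hcont.1 h1).2, fun t ht => ((heq h1 t ht).1 (h2 t ht)).1,
      fun t ht => ((heq h1 t ht).1 (h2 t ht)).2⟩
  · rintro ⟨h1, h2, h3, h4⟩
    have hu := hcont.2 ⟨h1, h2⟩
    exact ⟨hu, fun t ht => (heq hu t ht).2 ⟨h3 t ht, h4 t ht⟩⟩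

theorem IsSecondOrderSolution.unique (hR : ∀ z y, inner ℝ (R z) y = inner ℝ z (J y))
    (hJi : Function.Injective J) (hRi : Function.Injective R) {T : ℝ} {y₀ : V} {φ : ℝ → H}
    {y y' : ℝ → V} {z z' : ℝ → H} (h : IsSecondOrderSolution J R T y₀ φ y z)
    (h' : IsSecondOrderSolution J R T y₀ φ y' z') :
    EqOn y y' (Icc 0 T) ∧ EqOn z z' (Icc 0 T) := by
  have h1 := isIntegralSolution_iff (u := fun t => WithLp.toLp 2 (y t, z t)) |>.2 h
  have h2 := isIntegralSolution_iff (u := fun t => WithLp.toLp 2 (y' t, z' t)) |>.2 h'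
  have h3 := h1.eqOn (inner_skew_self hR) (skew_injective hJi hRi) h2
  exact ⟨fun t ht => congrArg WithLp.fst (h3 ht), fun t ht => congrArg WithLp.snd (h3 ht)⟩

theorem IsSecondOrderSolution.add {T : ℝ} {y₀ y₁ : V} {φ ψ : ℝ → H}
    {y y' : ℝ → V} {z z' : ℝ → H} (h : IsSecondOrderSolution J R T y₀ φ y z)
    (h' : IsSecondOrderSolution J R T y₁ ψ y' z') :
    IsSecondOrderSolution J R T (y₀ + y₁) (fun t => φ t + ψ t) (fun t => y t + y' t)
      (fun t => z t + z' t) := by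
  have h1 := isIntegralSolution_iff (u := fun t => WithLp.toLp 2 (y t, z t)) |>.2 h
  have h2 := isIntegralSolution_iff (u := fun t => WithLp.toLp 2 (y' t, z' t)) |>.2 h'
  exact isIntegralSolution_iff (u := fun t => WithLp.toLp 2 (y t + y' t, z t + z' t)) |>.1
    ((h1.add h2).congr_data fun t _ => (map_add (skew J R) _ _).symm)

theorem IsSecondOrderSolution.smul {T : ℝ} {y₀ : V} {φ : ℝ → H} {y : ℝ → V} {z : ℝ → H}
    (h : IsSecondOrderSolution J R T y₀ φ y z) (a : ℝ) :
    IsSecondOrderSolution J R T (a • y₀) (fun t => a • φ t) (fun t => a • y t)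
      (fun t => a • z t) := by
  have h1 := isIntegralSolution_iff (u := fun t => WithLp.toLp 2 (y t, z t)) |>.2 h
  exact isIntegralSolution_iff (u := fun t => WithLp.toLp 2 (a • y t, a • z t)) |>.1
    ((h1.smul a).congr_data fun t _ => (map_smul (skew J R) _ _).symm)

theorem exists_isSecondOrderSolution_initial (hR : ∀ z y, inner ℝ (R z) y = inner ℝ z (J y))
    (hJi : Function.Injective J) (hRi : Function.Injective R) (T : ℝ) (y₀ : V) (z₀ : H) :
    ∃ y z, IsSecondOrderSolution J R T y₀ (fun _ => z₀) y z := by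
  obtain ⟨S, M, -, hS, -⟩ := exists_semigroup (π := projFst V H) (inner_skew_self hR)
    (skew_injective hJi hRi) T
  exact ⟨_, _, isIntegralSolution_iff.1 (hS (WithLp.toLp 2 (y₀, z₀)))⟩

theorem exists_isSecondOrderSolution_source (hR : ∀ z y, inner ℝ (R z) y = inner ℝ z (J y))
    (hJi : Function.Injective J) (hRi : Function.Injective R) {T : ℝ} (hT : 0 ≤ T) {X 𝒲 : Type*}
    [NormedAddCommGroup X]
    [InnerProductSpace ℝ X] [NormedAddCommGroup 𝒲] [InnerProductSpace ℝ 𝒲] [CompleteSpace 𝒲]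
    (j : X →L[ℝ] H) {σ : ℝ → X →L[ℝ] 𝒲} {Φ : ℝ → 𝒲 →L[ℝ] H}
    (hσ : ∀ a ∈ Icc 0 T, ∀ b ∈ Icc 0 T, ∀ h k : X,
      inner ℝ (σ a h) (σ b k) = (T - max a b) * inner ℝ h k)
    (hΦ : ∀ t ∈ Icc 0 T, ∀ a ∈ Icc 0 T, ∀ h, Φ t (σ a h) = max (t - a) 0 • j h)
    (hdense : ∀ W, (∀ a ∈ Icc 0 T, ∀ h, inner ℝ (σ a h) W = 0) → W = 0) :
    ∃ C, 0 ≤ C ∧ ∀ W, ∃ y z, IsSecondOrderSolution J R T 0 (fun t => Φ t W) y z ∧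
      ∀ t ∈ Icc 0 T, ‖y t‖ ≤ C * ‖W‖ := by
  obtain ⟨C, hC, h⟩ := exists_integralSolution_source (π := projFst V H) (inner_skew_self hR)
    (skew_injective hJi hRi) hT (inSnd V H ∘L j) (Φ := fun t => inSnd V H ∘L Φ t) hσ
    (fun t ht a ha h => by
      rw [ContinuousLinearMap.comp_apply, hΦ t ht a ha, map_smul]
      rfl) hdense
  refine ⟨C, hC, fun W => ?_⟩
  obtain ⟨u, hu, hub⟩ := h W
  refine ⟨_, _, isIntegralSolution_iff.1 hu, fun t ht => le_trans ?_ (hub t ht)⟩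
  exact WithLp.norm_fst_le _ _

end SecondOrder

/-! ### Primitives in `L²(0,l)` and integration by parts. -/

section Primitive

variable {l : ℝ}

theorem L2.inner_eq (f g : L2 l) :
    inner ℝ f g = ∫ x in Ioo 0 l, f x * g x := by
  rw [MeasureTheory.L2.inner_def]
  refine integral_congr_ae (Filter.Eventually.of_forall fun x => ?_)
  simp [mul_comm]

theorem L2.abs_integral_le {x : ℝ} (h0 : 0 ≤ x) (hx : x ≤ l) (g : L2 l) :
    |∫ s in (0 : ℝ)..x, g s| ≤ √l * ‖g‖ := by
  have hfin : (volume.restrict (Ioo 0 l)) (Ioo 0 x) ≠ ⊤ := measure_ne_top _ _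
  have h1 := MeasureTheory.L2.inner_indicatorConstLp_one (𝕜 := ℝ) measurableSet_Ioo hfin g
  rw [Measure.restrict_restrict measurableSet_Ioo,
    inter_eq_left.2 (Ioo_subset_Ioo_right hx), ← integral_Ioc_eq_integral_Ioo,
    ← intervalIntegral.integral_of_le h0] at h1
  rw [← h1]
  refine (abs_real_inner_le_norm _ _).trans ?_
  gcongr
  rw [norm_indicatorConstLp (by simp) (by simp)]
  have h2 : (volume.restrict (Ioo 0 l)).real (Ioo 0 x) = x := by
    rw [measureReal_restrict_apply measurableSet_Ioo, inter_eq_left.2 (Ioo_subset_Ioo_right hx)]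
    simp [h0]
  rw [h2, Real.sqrt_eq_rpow]
  simp only [norm_one, ENNReal.toReal_ofNat, one_mul]
  exact Real.rpow_le_rpow h0 hx (by norm_num)

theorem L2.continuousOn_primitive (hl : 0 ≤ l) (g : L2 l) :
    ContinuousOn (fun x => ∫ s in (0 : ℝ)..x, g s) (Icc 0 l) := by
  have := intervalIntegral.continuousOn_primitive_interval' (μ := volume) (a := 0)
    (L2.intervalIntegrable hl le_rfl g) left_mem_uIcc
  rwa [uIcc_of_le hl] at this

theorem L2.memLp_primitive (hl : 0 ≤ l) (g : L2 l) :
    MemLp (fun x => ∫ s in (0 : ℝ)..x, g s) 2 (volume.restrict (Ioo 0 l)) := by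
  refine MemLp.of_bound (((L2.continuousOn_primitive hl g).mono
    Ioo_subset_Icc_self).aestronglyMeasurable measurableSet_Ioo) (√l * ‖g‖) ?_
  filter_upwards [ae_restrict_mem measurableSet_Ioo] with x hx
  exact L2.abs_integral_le hx.1.le hx.2.le g

variable [hl : Fact (0 < l)]

/-- The operator `g ↦ ∫₀ˣ g` on `L²(0,l)`. -/
def prim : L2 l →L[ℝ] L2 l :=
  LinearMap.mkContinuous
    { toFun := fun g => (L2.memLp_primitive hl.out.le g).toLp
      map_add' := fun g h => by
        rw [← MemLp.toLp_add]
        apply MemLp.toLp_congr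
        filter_upwards [ae_restrict_mem measurableSet_Ioo] with x hx
        exact L2.integral_add hx.1.le hx.2.le g h
      map_smul' := fun c g => by
        rw [RingHom.id_apply, ← MemLp.toLp_const_smul]
        apply MemLp.toLp_congr
        filter_upwards [ae_restrict_mem measurableSet_Ioo] with x hx
        exact L2.integral_smul hx.1.le hx.2.le c g }
    (√l * √l) fun g => by
      refine (Lp.norm_le_of_ae_bound (C := √l * ‖g‖) (by positivity) ?_).trans_eq ?_
      · filter_upwards [MemLp.coeFn_toLp (L2.memLp_primitive hl.out.le g),
          ae_restrict_mem measurableSet_Ioo] with x h hx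
        simp only [LinearMap.coe_mk, AddHom.coe_mk]
        rw [h]
        exact L2.abs_integral_le hx.1.le hx.2.le g
      · have h1 : measureUnivNNReal (volume.restrict (Ioo 0 l)) = Real.toNNReal l := by
          rw [measureUnivNNReal, Measure.restrict_apply_univ, Real.volume_Ioo, sub_zero]
          rfl
        rw [h1, Real.sqrt_eq_rpow, Real.coe_toNNReal _ hl.out.le]
        simp only [ENNReal.toReal_ofNat, one_div]
        ring

theorem prim_ae (g : L2 l) : ∀ᵐ x ∂(volume.restrict (Ioo 0 l)),
    prim g x = ∫ s in (0 : ℝ)..x, g s :=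
  MemLp.coeFn_toLp (L2.memLp_primitive hl.out.le g)

/-- The functional `g ↦ ∫₀ˡ g` on `L²(0,l)`. -/
def total : L2 l →L[ℝ] ℝ :=
  LinearMap.mkContinuous
    { toFun := fun g => ∫ s in (0 : ℝ)..l, g s
      map_add' := fun g h => L2.integral_add hl.out.le le_rfl g h
      map_smul' := fun c g => L2.integral_smul hl.out.le le_rfl c g }
    (√l) fun g => L2.abs_integral_le hl.out.le le_rfl g

theorem total_apply (g : L2 l) : total g = ∫ s in (0 : ℝ)..l, g s := rfl

omit hl in
theorem coeFn_const_ae (c : ℝ) : ∀ᵐ x ∂(volume.restrict (Ioo 0 l)),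
    (Lp.const 2 (volume.restrict (Ioo 0 l)) c : L2 l) x = c :=
  Lp.coeFn_const 2 _ c

/-- Constants in `L²(0,l)`. -/
abbrev cst (l c : ℝ) : L2 l := Lp.const 2 (volume.restrict (Ioo 0 l)) c

theorem inner_cst_left (c : ℝ) (g : L2 l) : inner ℝ (cst l c) g = c * total g := by
  rw [L2.inner_eq, total_apply, intervalIntegral.integral_of_le hl.out.le,
    integral_Ioc_eq_integral_Ioo, ← integral_const_mul]
  refine integral_congr_ae ?_
  filter_upwards [coeFn_const_ae (l := l) c] with x hx
  rw [hx]

/-- Integration by parts for absolutely continuous functions. Both primitives vanish at `0`, so only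
the boundary term at `l` remains. -/
theorem inner_prim_add (f g : L2 l) :
    inner ℝ f (prim g) + inner ℝ (prim f) g = total f * total g := by
  have hf := L2.intervalIntegrable hl.out.le le_rfl f
  have hg := L2.intervalIntegrable hl.out.le le_rfl g
  have hF := hf.absolutelyContinuousOnInterval_intervalIntegral (c := 0) left_mem_uIcc
  have hG := hg.absolutelyContinuousOnInterval_intervalIntegral (c := 0) left_mem_uIcc
  have h := hF.integral_mul_deriv_eq_deriv_mul hG
  simp only [intervalIntegral.integral_same, mul_zero, sub_zero] at h
  have hfd := hf.ae_hasDerivAt_integral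
  have hgd := hg.ae_hasDerivAt_integral
  have h1 : inner ℝ f (prim g) = ∫ x in (0 : ℝ)..l,
      deriv (fun x => ∫ v in (0 : ℝ)..x, f v) x * ∫ v in (0 : ℝ)..x, g v := by
    rw [L2.inner_eq, intervalIntegral.integral_of_le hl.out.le, integral_Ioc_eq_integral_Ioo]
    refine integral_congr_ae ?_
    filter_upwards [prim_ae g, ae_restrict_of_ae hfd, ae_restrict_mem measurableSet_Ioo]
      with x h1 h2 hx
    have hx' : x ∈ uIcc 0 l := by rw [uIcc_of_le hl.out.le]; exact Ioo_subset_Icc_self hx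
    rw [h1, (h2 hx' 0 left_mem_uIcc).deriv]
  have h2 : inner ℝ (prim f) g = ∫ x in (0 : ℝ)..l,
      (∫ v in (0 : ℝ)..x, f v) * deriv (fun x => ∫ v in (0 : ℝ)..x, g v) x := by
    rw [L2.inner_eq, intervalIntegral.integral_of_le hl.out.le, integral_Ioc_eq_integral_Ioo]
    refine integral_congr_ae ?_
    filter_upwards [prim_ae f, ae_restrict_of_ae hgd, ae_restrict_mem measurableSet_Ioo]
      with x h1 h2 hx
    have hx' : x ∈ uIcc 0 l := by rw [uIcc_of_le hl.out.le]; exact Ioo_subset_Icc_self hx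
    rw [h1, (h2 hx' 0 left_mem_uIcc).deriv]
  rw [h1, h2, h, total_apply, total_apply]
  ring

/-- By continuity the a.e. identity holds on all of `[0,l]`: the point `0` gives `a`, and Lebesgue
differentiation gives `g`. Thus boundary value and weak derivative are determined by the function.
-/
theorem cst_add_prim_eq_zero {a : ℝ} {g : L2 l} (h : cst l a + prim g = 0) : a = 0 ∧ g = 0 := by
  have hae : ∀ᵐ x ∂(volume.restrict (Ioo 0 l)), a + ∫ s in (0 : ℝ)..x, g s = 0 := by
    have h0 : ⇑(cst l a + prim g) =ᵐ[volume.restrict (Ioo 0 l)] 0 := by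
      rw [h]
      exact Lp.coeFn_zero _ _ _
    filter_upwards [h0, Lp.coeFn_add (cst l a) (prim g), coeFn_const_ae (l := l) a, prim_ae g]
      with x h1 h2 h3 h4
    rw [← h4, ← h3]
    exact h2.symm.trans h1
  have hall : EqOn (fun x => a + ∫ s in (0 : ℝ)..x, g s) (fun _ => 0) (Icc 0 l) := by
    refine Measure.eqOn_Icc_of_ae_eq volume hl.out.ne ?_
      (continuousOn_const.add (L2.continuousOn_primitive hl.out.le g)) continuousOn_const
    rw [← restrict_Ioo_eq_restrict_Icc]
    exact hae
  have ha : a = 0 := by simpa using hall (left_mem_Icc.2 hl.out.le)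
  refine ⟨ha, ?_⟩
  rw [Lp.eq_zero_iff_ae_eq_zero]
  filter_upwards [ae_restrict_of_ae (L2.intervalIntegrable hl.out.le le_rfl g).ae_hasDerivAt_integral,
    ae_restrict_mem measurableSet_Ioo] with x h2 hx
  have hx' : x ∈ uIcc 0 l := by rw [uIcc_of_le hl.out.le]; exact Ioo_subset_Icc_self hx
  have h3 := h2 hx' 0 left_mem_uIcc
  have h4 : (fun x => ∫ s in (0 : ℝ)..x, g s) =ᶠ[nhds x] fun _ => 0 := by
    filter_upwards [Ioo_mem_nhds hx.1 hx.2] with y hy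
    have := hall (Ioo_subset_Icc_self hy)
    simpa [ha] using this
  exact h3.unique ((hasDerivAt_const x (0 : ℝ)).congr_of_eventuallyEq h4)

theorem hasWeakDeriv_iff {U : LL l} {g : L2 l} : HasWeakDeriv U g ↔
    U.fst = cst l U.snd.fst + prim g ∧ U.snd.snd = U.snd.fst + total g := by
  refine and_congr ?_ Iff.rfl
  rw [Lp.ext_iff]
  constructor
  · intro h
    filter_upwards [h, Lp.coeFn_add (cst l U.snd.fst) (prim g), coeFn_const_ae (l := l) U.snd.fst,
      prim_ae g] with x h1 h2 h3 h4
    rw [h1, h2, Pi.add_apply, h3, h4]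
  · intro h
    filter_upwards [h, Lp.coeFn_add (cst l U.snd.fst) (prim g), coeFn_const_ae (l := l) U.snd.fst,
      prim_ae g] with x h1 h2 h3 h4
    rw [h1, h2, Pi.add_apply, h3, h4]

end Primitive

/-! ### The space ℍ¹, and `ℬ` through the adjoint of the embedding. -/

section EnergySpace

variable {l : ℝ} [hl : Fact (0 < l)]

omit hl in
theorem LL.inner_eq (U V : LL l) : inner ℝ U V
    = inner ℝ U.fst V.fst + U.snd.fst * V.snd.fst + U.snd.snd * V.snd.snd := by
  rw [WithLp.prod_inner_apply, WithLp.prod_inner_apply, add_assoc]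
  simp [mul_comm]

theorem isClosed_H1 : IsClosed (H1 l : Set (WithLp 2 (LL l × L2 l))) := by
  have h : (H1 l : Set (WithLp 2 (LL l × L2 l))) =
      {p | p.fst.fst = cst l p.fst.snd.fst + prim p.snd} ∩
        {p | p.fst.snd.snd = p.fst.snd.fst + total p.snd} := by
    ext p
    exact hasWeakDeriv_iff
  have h1 : Continuous fun p : WithLp 2 (LL l × L2 l) => p.fst := (WithLp.fstL 2 ℝ _ _).continuous
  have h2 : Continuous fun p : WithLp 2 (LL l × L2 l) => p.snd := (WithLp.sndL 2 ℝ _ _).continuous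
  have h3 : Continuous fun p : LL l => p.fst := (WithLp.fstL 2 ℝ _ _).continuous
  have h4 : Continuous fun p : LL l => p.snd := (WithLp.sndL 2 ℝ _ _).continuous
  have h5 : Continuous fun p : WithLp 2 (ℝ × ℝ) => p.fst := (WithLp.fstL 2 ℝ _ _).continuous
  have h6 : Continuous fun p : WithLp 2 (ℝ × ℝ) => p.snd := (WithLp.sndL 2 ℝ _ _).continuous
  have h7 : Continuous (cst l) := (Lp.constL 2 (volume.restrict (Ioo 0 l)) ℝ).continuous
  rw [h]
  refine (isClosed_eq (h3.comp h1) ?_).inter (isClosed_eq (h6.comp (h4.comp h1)) ?_)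
  · exact (h7.comp (h5.comp (h4.comp h1))).add (prim.continuous.comp h2)
  · exact (h5.comp (h4.comp h1)).add (total.continuous.comp h2)

instance : CompleteSpace (H1 l) := isClosed_H1.completeSpace_coe

/-- The embedding of `ℍ¹` into `𝕃²`. -/
def emb : H1 l →L[ℝ] LL l := (WithLp.fstL 2 ℝ (LL l) (L2 l)) ∘L (H1 l).subtypeL

/-- The weak derivative of an element of `ℍ¹`. -/
def grad (Y : H1 l) : L2 l := (Y : WithLp 2 (LL l × L2 l)).snd

theorem H1.inner_eq (Y Z : H1 l) :
    inner ℝ Y Z = inner ℝ (emb Y) (emb Z) + inner ℝ (grad Y) (grad Z) := by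
  rw [Submodule.coe_inner, WithLp.prod_inner_apply]
  rfl

theorem fst_emb (Y : H1 l) : (emb Y).fst = cst l (emb Y).snd.fst + prim (grad Y) :=
  (hasWeakDeriv_iff.1 Y.2).1

theorem right_emb (Y : H1 l) : (emb Y).snd.snd = (emb Y).snd.fst + total (grad Y) :=
  (hasWeakDeriv_iff.1 Y.2).2

/-- The element of `ℍ¹` with value `a` at `0` and weak derivative `g`. -/
def H1.mk (a : ℝ) (g : L2 l) : H1 l :=
  ⟨WithLp.toLp 2 (WithLp.toLp 2 (cst l a + prim g, WithLp.toLp 2 (a, a + total g)), g),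
    hasWeakDeriv_iff.2 ⟨rfl, rfl⟩⟩

theorem emb_injective : Function.Injective (emb : H1 l →L[ℝ] LL l) := by
  rw [injective_iff_map_eq_zero]
  intro Y hY
  have h := (fst_emb Y)
  rw [hY] at h
  have hg := (cst_add_prim_eq_zero h.symm).2
  apply Subtype.ext
  apply WithLp.ofLp_injective
  exact Prod.ext hY hg

theorem exists_adjoint {V H : Type*} [NormedAddCommGroup V] [InnerProductSpace ℝ V]
    [NormedAddCommGroup H] [InnerProductSpace ℝ H] [CompleteSpace V] [CompleteSpace H]
    (J : V →L[ℝ] H) : ∃ R : H →L[ℝ] V, ∀ z y, inner ℝ (R z) y = inner ℝ z (J y) :=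
  ⟨ContinuousLinearMap.adjoint J, fun z y => ContinuousLinearMap.adjoint_inner_left J y z⟩

theorem exists_adjoint_emb :
    ∃ R : LL l →L[ℝ] H1 l, ∀ f Y, inner ℝ (R f) Y = inner ℝ f (emb Y) := by
  obtain ⟨R, hR⟩ := exists_adjoint (V := H1 l) (H := LL l) emb
  exact ⟨R, fun f Y => hR f Y⟩

/-- The adjoint of the embedding; `adj f` solves `(1 - ℬ) u = f`. -/
def adj : LL l →L[ℝ] H1 l := exists_adjoint_emb.choose

theorem adj_inner (f : LL l) (Y : H1 l) : inner ℝ (adj f) Y = inner ℝ f (emb Y) :=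
  exists_adjoint_emb.choose_spec f Y

/-- Integration by parts rewrites the pairing in the free parameters `a` and `g` of a test element,
which can then be varied independently. -/
theorem inner_emb_mk (V : LL l) (a : ℝ) (g : L2 l) : inner ℝ V (emb (H1.mk a g)) =
    a * (total V.fst + V.snd.fst + V.snd.snd) + (total V.fst + V.snd.snd) * total g
      - inner ℝ (prim V.fst) g := by
  have h1 : inner ℝ V (emb (H1.mk a g)) = inner ℝ V.fst (cst l a + prim g)
      + V.snd.fst * a + V.snd.snd * (a + total g) := LL.inner_eq _ _
  have h2 := inner_prim_add V.fst g
  rw [h1, inner_add_right, real_inner_comm, inner_cst_left]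
  linear_combination h2

theorem H1.mk_eta (Y : H1 l) : H1.mk (emb Y).snd.fst (grad Y) = Y := by
  apply emb_injective
  apply WithLp.ofLp_injective
  refine Prod.ext (fst_emb Y).symm ?_
  apply WithLp.ofLp_injective
  exact Prod.ext rfl (right_emb Y).symm

/-- Green's formula: the boundary entries `u'(0)` and `-u'(l)` of `ℬ U` match the boundary terms, so
`∫ u' z' = -⟨ℬ U, Z⟩`. -/
theorem IsB.exists_eq_adj {U V : LL l} (h : IsB U V) : ∃ Y : H1 l, emb Y = U ∧ Y = adj (U - V) := by
  obtain ⟨U', hU, hU', h0, hl'⟩ := h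
  refine ⟨⟨WithLp.toLp 2 (U, U'.fst), hU⟩, rfl, ?_⟩
  set Y : H1 l := ⟨WithLp.toLp 2 (U, U'.fst), hU⟩ with hY
  refine ext_inner_right ℝ fun Z => ?_
  rw [hasWeakDeriv_iff] at hU'
  rw [adj_inner, H1.inner_eq, inner_sub_left]
  have h1 : emb Y = U := rfl
  have h2 : grad Y = U'.fst := rfl
  have h3 := inner_emb_mk V (emb Z).snd.fst (grad Z)
  rw [H1.mk_eta] at h3
  rw [h1, h2, h3, hU'.1, inner_add_left, inner_cst_left, hl', h0, hU'.2]
  ring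

/-- Regularity of the weak solution. Test elements with `g = 0` give a compatibility condition on
`q`; those with `a = 0` then identify the gradient as `q.snd.fst` plus the primitive of `q.fst`, and
compatibility gives its value `-q.snd.snd` at `l`. -/
theorem isB_emb_adj (f : LL l) : IsB (emb (adj f)) (emb (adj f) - f) := by
  set Y : H1 l := adj f with hY
  set q : LL l := emb Y - f with hq
  have key : ∀ a g, a * (total q.fst + q.snd.fst + q.snd.snd) + (total q.fst + q.snd.snd) * total g
      - inner ℝ (prim q.fst) g + inner ℝ (grad Y) g = 0 := by
    intro a g
    have h := adj_inner f (H1.mk a g)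
    rw [← hY, H1.inner_eq] at h
    rw [← inner_emb_mk, hq, inner_sub_left]
    have h2 : grad (H1.mk a g) = g := rfl
    rw [h2] at h
    linarith
  have h0 : total q.fst + q.snd.fst + q.snd.snd = 0 := by simpa using key 1 0
  have h1 : grad Y = cst l q.snd.fst + prim q.fst := by
    refine ext_inner_right ℝ fun g => ?_
    have := key 0 g
    rw [inner_add_left, inner_cst_left]
    linear_combination this - total g * h0
  refine ⟨WithLp.toLp 2 (grad Y, WithLp.toLp 2 (q.snd.fst, -q.snd.snd)), Y.2,
    hasWeakDeriv_iff.2 ⟨h1, ?_⟩, rfl, (neg_neg _).symm⟩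
  show -q.snd.snd = q.snd.fst + total q.fst
  linarith

theorem adj_injective : Function.Injective (adj : LL l →L[ℝ] H1 l) := by
  rw [injective_iff_map_eq_zero]
  intro f hf
  obtain ⟨U', hU, hU', h0, hl'⟩ := isB_emb_adj f
  rw [hf, map_zero] at hU hU' h0 hl'
  rw [zero_sub] at hU' h0 hl'
  rw [hasWeakDeriv_iff] at hU hU'
  have h1 : U'.fst = 0 := (cst_add_prim_eq_zero hU.1.symm).2
  rw [h1] at hU'
  obtain ⟨h2, h3⟩ := cst_add_prim_eq_zero hU'.1.symm
  rw [h2, h3] at hU'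
  rw [h2] at h0
  rw [hU'.2, map_zero, add_zero, neg_zero] at hl'
  rw [← neg_eq_zero]
  apply WithLp.ofLp_injective
  refine Prod.ext h3 ?_
  apply WithLp.ofLp_injective
  exact Prod.ext h0 hl'

theorem isB_iff {U V : LL l} : IsB U V ↔ ∃ Y : H1 l, emb Y = U ∧ Y = adj (U - V) := by
  refine ⟨IsB.exists_eq_adj, ?_⟩
  rintro ⟨Y, rfl, hY⟩
  have h := isB_emb_adj (emb Y - V)
  rwa [← hY, sub_sub_cancel] at h

end EnergySpace

/-! ### Products `g(t) h(x)` in `L²((0,T) × (0,l))` and their totality. -/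

section Tensor

variable {l T : ℝ}

/-- The space `L²((0,T) × (0,l))`. -/
abbrev L2Prod (l T : ℝ) : Type :=
  Lp ℝ 2 ((volume : Measure (ℝ × ℝ)).restrict (Ioo 0 T ×ˢ Ioo 0 l))

theorem restrict_prod_eq (l T : ℝ) : (volume : Measure (ℝ × ℝ)).restrict (Ioo 0 T ×ˢ Ioo 0 l)
    = (volume.restrict (Ioo 0 T)).prod (volume.restrict (Ioo 0 l)) := by
  rw [Measure.prod_restrict, Measure.volume_eq_prod]

instance : IsFiniteMeasure ((volume : Measure (ℝ × ℝ)).restrict (Ioo 0 T ×ˢ Ioo 0 l)) := by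
  rw [restrict_prod_eq]
  infer_instance

theorem L2Prod.inner_eq (f g : L2Prod l T) :
    inner ℝ f g = ∫ p in Ioo 0 T ×ˢ Ioo 0 l, f p * g p := by
  rw [MeasureTheory.L2.inner_def]
  refine integral_congr_ae (Filter.Eventually.of_forall fun x => ?_)
  simp [mul_comm]

theorem memLp_tensor (g : L2 T) (h : L2 l) : MemLp (fun p : ℝ × ℝ => g p.1 * h p.2) 2
    ((volume : Measure (ℝ × ℝ)).restrict (Ioo 0 T ×ˢ Ioo 0 l)) := by
  rw [restrict_prod_eq]
  have hm : AEStronglyMeasurable (fun p : ℝ × ℝ => g p.1 * h p.2)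
      ((volume.restrict (Ioo 0 T)).prod (volume.restrict (Ioo 0 l))) :=
    (Lp.aestronglyMeasurable g).comp_fst.mul (Lp.aestronglyMeasurable h).comp_snd
  rw [memLp_two_iff_integrable_sq hm]
  simp only [mul_pow]
  exact (Lp.memLp g).integrable_sq.mul_prod (Lp.memLp h).integrable_sq

theorem ae_prod_fst {p : ℝ → Prop} (h : ∀ᵐ s ∂(volume.restrict (Ioo 0 T)), p s) :
    ∀ᵐ q ∂((volume : Measure (ℝ × ℝ)).restrict (Ioo 0 T ×ˢ Ioo 0 l)), p q.1 := by
  rw [restrict_prod_eq]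
  exact Measure.quasiMeasurePreserving_fst.ae h

theorem ae_prod_snd {p : ℝ → Prop} (h : ∀ᵐ s ∂(volume.restrict (Ioo 0 l)), p s) :
    ∀ᵐ q ∂((volume : Measure (ℝ × ℝ)).restrict (Ioo 0 T ×ˢ Ioo 0 l)), p q.2 := by
  rw [restrict_prod_eq]
  exact Measure.quasiMeasurePreserving_snd.ae h

theorem inner_toLp_tensor (g g' : L2 T) (h h' : L2 l) :
    inner ℝ (memLp_tensor g h).toLp (memLp_tensor g' h').toLp = inner ℝ g g' * inner ℝ h h' := by
  rw [L2Prod.inner_eq, L2.inner_eq, L2.inner_eq, ← integral_prod_mul, ← restrict_prod_eq]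
  refine integral_congr_ae ?_
  filter_upwards [(memLp_tensor g h).coeFn_toLp, (memLp_tensor g' h').coeFn_toLp] with p h1 h2
  rw [h1, h2]
  ring

/-- The product `(t, x) ↦ g t * h x` of `g ∈ L²(0,T)` and `h ∈ L²(0,l)`. -/
def tensor : L2 T →L[ℝ] L2 l →L[ℝ] L2Prod l T :=
  LinearMap.mkContinuous₂
    (LinearMap.mk₂ ℝ (fun g h => (memLp_tensor g h).toLp)
      (fun g g' h => by
        rw [← MemLp.toLp_add]
        apply MemLp.toLp_congr
        filter_upwards [ae_prod_fst (Lp.coeFn_add g g')] with p hp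
        rw [hp, Pi.add_apply, Pi.add_apply, add_mul])
      (fun c g h => by
        rw [← MemLp.toLp_const_smul]
        apply MemLp.toLp_congr
        filter_upwards [ae_prod_fst (Lp.coeFn_smul c g)] with p hp
        rw [hp, Pi.smul_apply, Pi.smul_apply, smul_mul_assoc])
      (fun g h h' => by
        rw [← MemLp.toLp_add]
        apply MemLp.toLp_congr
        filter_upwards [ae_prod_snd (Lp.coeFn_add h h')] with p hp
        rw [hp, Pi.add_apply, Pi.add_apply, mul_add])
      (fun c g h => by
        rw [← MemLp.toLp_const_smul]
        apply MemLp.toLp_congr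
        filter_upwards [ae_prod_snd (Lp.coeFn_smul c h)] with p hp
        rw [hp, Pi.smul_apply, Pi.smul_apply, mul_smul_comm]))
    1 (fun g h => by
      refine le_of_sq_le_sq (le_of_eq ?_) (by positivity)
      have := inner_toLp_tensor g g h h
      simp only [real_inner_self_eq_norm_sq] at this
      rw [one_mul, mul_pow, ← this]
      rfl)

theorem tensor_ae (g : L2 T) (h : L2 l) :
    ∀ᵐ p ∂((volume : Measure (ℝ × ℝ)).restrict (Ioo 0 T ×ˢ Ioo 0 l)),
      tensor g h p = g p.1 * h p.2 :=
  (memLp_tensor g h).coeFn_toLp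

theorem inner_tensor (g g' : L2 T) (h h' : L2 l) :
    inner ℝ (tensor g h) (tensor g' h') = inner ℝ g g' * inner ℝ h h' :=
  inner_toLp_tensor g g' h h'

/-- The indicator function of a measurable set as an element of `L²(0,l)`. -/
abbrev ind (l : ℝ) {A : Set ℝ} (hA : MeasurableSet A) : L2 l :=
  indicatorConstLp 2 hA (measure_ne_top _ _) 1

theorem inner_tensor_ind (F : L2Prod l T) {A B : Set ℝ} (hA : MeasurableSet A)
    (hB : MeasurableSet B) : inner ℝ (tensor (ind T hA) (ind l hB)) F
      = ∫ p in A ×ˢ B, F p ∂(volume.restrict (Ioo 0 T ×ˢ Ioo 0 l)) := by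
  rw [L2Prod.inner_eq, ← integral_indicator (hA.prod hB)]
  refine integral_congr_ae ?_
  filter_upwards [tensor_ae (ind T hA) (ind l hB),
    ae_prod_fst (l := l) (indicatorConstLp_coeFn (p := 2) (hs := hA)
      (hμs := measure_ne_top (volume.restrict (Ioo 0 T)) A) (c := (1 : ℝ))),
    ae_prod_snd (T := T) (indicatorConstLp_coeFn (p := 2) (hs := hB)
      (hμs := measure_ne_top (volume.restrict (Ioo 0 l)) B) (c := (1 : ℝ)))] with p h1 h2 h3
  rw [h1, h2, h3]
  by_cases hp1 : p.1 ∈ A <;> by_cases hp2 : p.2 ∈ B <;> simp [hp1, hp2, indicator]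

/-- The integral of `F` vanishes on rectangles, which form a π-system generating the product
σ-algebra, hence on every measurable set. -/
theorem eq_zero_of_forall_inner_tensor_ind {F : L2Prod l T}
    (h : ∀ (A B : Set ℝ) (hA : MeasurableSet A) (hB : MeasurableSet B),
      inner ℝ (tensor (ind T hA) (ind l hB)) F = 0) : F = 0 := by
  set μ := (volume : Measure (ℝ × ℝ)).restrict (Ioo 0 T ×ˢ Ioo 0 l) with hμ
  have hF : Integrable F μ := (Lp.memLp F).integrable (by norm_num)
  have key : ∀ S, MeasurableSet S → ∫ p in S, F p ∂μ = 0 := by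
    intro S hS
    induction S, hS using MeasurableSpace.induction_on_inter generateFrom_prod.symm isPiSystem_prod with
    | empty => simp
    | basic S hS =>
      obtain ⟨A, hA, B, hB, rfl⟩ := hS
      rw [← inner_tensor_ind F hA hB]
      exact h A B hA hB
    | compl S hS ih =>
      have h1 := integral_add_compl hS hF
      have h2 := h univ univ MeasurableSet.univ MeasurableSet.univ
      rw [inner_tensor_ind, univ_prod_univ, Measure.restrict_univ] at h2
      rwa [ih, zero_add, h2] at h1
    | iUnion f hd hf ih =>
      rw [integral_iUnion hf hd hF.integrableOn]
      simp [ih]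
  rw [Lp.eq_zero_iff_ae_eq_zero]
  exact hF.ae_eq_zero_of_forall_setIntegral_eq_zero fun S hS _ => key S hS

theorem L2.eq_zero_of_forall_inner_ind (hT : 0 < T) {g : L2 T}
    (h : ∀ a ∈ Icc 0 T, inner ℝ (ind T (measurableSet_Ioo (a := a) (b := T))) g = 0) : g = 0 := by
  have : Fact (0 < T) := ⟨hT⟩
  have h1 : ∀ a ∈ Icc 0 T, ∫ s in a..T, g s = 0 := by
    intro a ha
    have := h a ha
    rw [MeasureTheory.L2.inner_indicatorConstLp_one,
      Measure.restrict_restrict measurableSet_Ioo,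
      inter_eq_left.2 (Ioo_subset_Ioo_left ha.1), ← integral_Ioc_eq_integral_Ioo,
      ← intervalIntegral.integral_of_le ha.2] at this
    exact this
  refine (cst_add_prim_eq_zero (a := 0) ?_).2
  rw [show cst T 0 = 0 from map_zero _, zero_add, Lp.eq_zero_iff_ae_eq_zero]
  filter_upwards [prim_ae g, ae_restrict_mem measurableSet_Ioo] with x hx hxm
  have h2 := h1 x (Ioo_subset_Icc_self hxm)
  have h3 := h1 0 (left_mem_Icc.2 hT.le)
  have hi := L2.intervalIntegrable hT.le le_rfl g
  have hsub : IntervalIntegrable g volume 0 x := L2.intervalIntegrable hxm.1.le hxm.2.le g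
  have h4 := intervalIntegral.integral_add_adjacent_intervals hsub (hsub.symm.trans hi)
  rw [h2, h3, add_zero] at h4
  rw [hx, h4]
  rfl

theorem inner_ind_ind {a t : ℝ} (ha : a ∈ Icc 0 T) (ht : t ∈ Icc 0 T) :
    inner ℝ (ind T (measurableSet_Ioo (a := a) (b := T)))
      (ind T (measurableSet_Ioo (a := 0) (b := t))) = max (t - a) 0 := by
  rw [MeasureTheory.L2.real_inner_indicatorConstLp_one_indicatorConstLp_one,
    measureReal_restrict_apply (measurableSet_Ioo.inter measurableSet_Ioo), Ioo_inter_Ioo,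
    Ioo_inter_Ioo, Real.volume_real_Ioo, sup_eq_left.2 ha.1, inf_eq_right.2 ht.2,
    sup_eq_left.2 ha.1, inf_eq_left.2 ht.2]

theorem inner_ind_ind_right {a b : ℝ} (ha : a ∈ Icc 0 T) (hb : b ∈ Icc 0 T) :
    inner ℝ (ind T (measurableSet_Ioo (a := a) (b := T)))
      (ind T (measurableSet_Ioo (a := b) (b := T))) = T - max a b := by
  rw [MeasureTheory.L2.real_inner_indicatorConstLp_one_indicatorConstLp_one,
    measureReal_restrict_apply (measurableSet_Ioo.inter measurableSet_Ioo), Ioo_inter_Ioo,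
    Ioo_inter_Ioo, Real.volume_real_Ioo, inf_idem, inf_idem,
    sup_eq_left.2 (ha.1.trans le_sup_left)]
  exact max_eq_left (sub_nonneg.2 (max_le ha.2 hb.2))

end Tensor

/-! ### Separated sources and the time integral of a source. -/

section Step

variable {l T : ℝ}

/-- The space `L²(0,l) × ℝ` of values of a source at a fixed time. -/
abbrev SourceValue (l : ℝ) : Type := WithLp 2 (L2 l × ℝ)

/-- The source `(t, x) ↦ g t * h x`, `t ↦ c * g t` for `(h, c) ∈ L²(0,l) × ℝ`. -/
def sepSource (g : L2 T) : SourceValue l →L[ℝ] Source l T :=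
  (WithLp.prodContinuousLinearEquiv 2 ℝ _ _).symm.toContinuousLinearMap ∘L
    ((tensor g ∘L WithLp.fstL 2 ℝ (L2 l) ℝ).prod
      ((ContinuousLinearMap.toSpanSingleton ℝ g) ∘L WithLp.sndL 2 ℝ (L2 l) ℝ))

/-- The source value `(h, c)` as the element `(h, c, 0)` of `𝕃²`. -/
def inLL (l : ℝ) : SourceValue l →L[ℝ] LL l :=
  (WithLp.prodContinuousLinearEquiv 2 ℝ _ _).symm.toContinuousLinearMap ∘L
    ((WithLp.fstL 2 ℝ (L2 l) ℝ).prod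
      ((WithLp.prodContinuousLinearEquiv 2 ℝ ℝ ℝ).symm.toContinuousLinearMap ∘L
        ((WithLp.sndL 2 ℝ (L2 l) ℝ).prod 0)))

theorem SourceValue.inner_eq (x y : SourceValue l) :
    inner ℝ x y = inner ℝ x.fst y.fst + x.snd * y.snd := by
  rw [mul_comm]
  rfl

theorem inner_sepSource (g g' : L2 T) (x x' : SourceValue l) :
    inner ℝ (sepSource g x) (sepSource g' x') = inner ℝ g g' * inner ℝ x x' := by
  have h : inner ℝ (sepSource g x) (sepSource g' x')
    = inner ℝ (tensor g x.fst) (tensor g' x'.fst) + inner ℝ (x.snd • g) (x'.snd • g') := rfl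
  rw [h, inner_tensor, inner_smul_left, inner_smul_right, SourceValue.inner_eq]
  simp only [conj_trivial]
  ring

theorem inner_sepSource_left (g : L2 T) (x : SourceValue l) (W : Source l T) :
    inner ℝ (sepSource g x) W = inner ℝ (tensor g x.fst) W.fst + x.snd * inner ℝ g W.snd := by
  have h : inner ℝ (sepSource g x) W
    = inner ℝ (tensor g x.fst) W.fst + inner ℝ (x.snd • g) W.snd := rfl
  rw [h, inner_smul_left]
  rfl

/-- For fixed `B`, the adjoint of `g ↦ g ⊗ 1_B` sends `F` to its integral over `B` in space. This
function of time is orthogonal to all indicators of `(a,T)`, hence zero, so `F` is orthogonal to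
every rectangle. -/
theorem Source.eq_zero_of_forall_inner (hT : 0 < T) {W : Source l T}
    (h : ∀ a ∈ Icc 0 T, ∀ x : SourceValue l,
      inner ℝ (sepSource (ind T (measurableSet_Ioo (a := a) (b := T))) x) W = 0) : W = 0 := by
  have h1 : ∀ a ∈ Icc 0 T, ∀ k : L2 l,
      inner ℝ (tensor (ind T (measurableSet_Ioo (a := a) (b := T))) k) W.fst = 0 := by
    intro a ha k
    have := h a ha (WithLp.toLp 2 (k, 0))
    rw [inner_sepSource_left] at this
    simpa using this
  have h2 : W.snd = 0 := L2.eq_zero_of_forall_inner_ind hT fun a ha => by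
    have := h a ha (WithLp.toLp 2 (0, 1))
    rw [inner_sepSource_left] at this
    simpa using this
  have h3 : W.fst = 0 := by
    refine eq_zero_of_forall_inner_tensor_ind fun A B hA hB => ?_
    obtain ⟨R, hR⟩ := exists_adjoint (tensor.flip (ind l hB) : L2 T →L[ℝ] L2Prod l T)
    have h4 : R W.fst = 0 := L2.eq_zero_of_forall_inner_ind hT fun a ha => by
      rw [real_inner_comm, hR, real_inner_comm]
      exact h1 a ha (ind l hB)
    have h5 := hR W.fst (ind T hA)
    rw [h4, inner_zero_left, real_inner_comm] at h5
    exact h5.symm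
  apply WithLp.ofLp_injective
  exact Prod.ext h3 h2

/-- Taking the time integral as an adjoint makes linearity and continuity automatic; Fubini recovers
the pointwise formula in `accumulated_fst`. -/
theorem exists_accumulated (l T : ℝ) : ∃ A : ℝ → Source l T →L[ℝ] SourceValue l, ∀ t W x,
    inner ℝ (A t W) x = inner ℝ W (sepSource (ind T (measurableSet_Ioo (a := 0) (b := t))) x) := by
  have h : ∀ t : ℝ, ∃ A : Source l T →L[ℝ] SourceValue l, ∀ W x, inner ℝ (A W) x
      = inner ℝ W (sepSource (ind T (measurableSet_Ioo (a := 0) (b := t))) x) := by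
    intro t
    obtain ⟨A, hA⟩ := exists_adjoint
      (sepSource (l := l) (ind T (measurableSet_Ioo (a := 0) (b := t))))
    exact ⟨A, fun W x => hA W x⟩
  choose A hA using h
  exact ⟨A, hA⟩

/-- The time integral `∫₀ᵗ (F(s,·), G(s)) ds` of a source, for `t ∈ [0,T]`. -/
def accumulated (t : ℝ) : Source l T →L[ℝ] SourceValue l := (exists_accumulated l T).choose t

theorem inner_accumulated (t : ℝ) (W : Source l T) (x : SourceValue l) :
    inner ℝ x (accumulated t W)
      = inner ℝ (sepSource (ind T (measurableSet_Ioo (a := 0) (b := t))) x) W := by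
  rw [real_inner_comm, real_inner_comm W]
  exact (exists_accumulated l T).choose_spec t W x

theorem accumulated_snd {t : ℝ} (ht : t ∈ Icc 0 T) (W : Source l T) :
    (accumulated t W).snd = ∫ s in (0 : ℝ)..t, W.snd s := by
  have h := inner_accumulated t W (WithLp.toLp 2 (0, 1))
  rw [SourceValue.inner_eq, inner_sepSource_left] at h
  change inner ℝ (0 : L2 l) (accumulated t W).fst + 1 * (accumulated t W).snd
    = inner ℝ (tensor _ 0) W.fst + 1 * inner ℝ _ W.snd at h
  rw [map_zero, inner_zero_left, inner_zero_left, zero_add, zero_add, one_mul, one_mul] at h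
  rw [h, MeasureTheory.L2.inner_indicatorConstLp_one, Measure.restrict_restrict measurableSet_Ioo,
      inter_eq_left.2 (Ioo_subset_Ioo_right ht.2), ← integral_Ioc_eq_integral_Ioo,
      ← intervalIntegral.integral_of_le ht.1]

theorem accumulated_fst {t : ℝ} (ht : t ∈ Icc 0 T) (W : Source l T) :
    ∀ᵐ x ∂(volume.restrict (Ioo 0 l)),
      (accumulated t W).fst x = ∫ s in (0 : ℝ)..t, W.fst (s, x) := by
  have hF : Integrable W.fst ((volume.restrict (Ioo 0 T)).prod (volume.restrict (Ioo 0 l))) := by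
    rw [← restrict_prod_eq]
    exact (Lp.memLp W.fst).integrable (by norm_num)
  have hFt : Integrable W.fst ((volume.restrict (Ioo 0 t)).prod (volume.restrict (Ioo 0 l))) :=
    hF.mono_measure (Measure.prod_mono
      (Measure.restrict_mono (Ioo_subset_Ioo_right ht.2) le_rfl) le_rfl)
  have heq : ∀ x, ∫ s in (0 : ℝ)..t, W.fst (s, x) = ∫ s in Ioo 0 t, W.fst (s, x) := fun x => by
    rw [intervalIntegral.integral_of_le ht.1, integral_Ioc_eq_integral_Ioo]
  simp only [heq]
  refine Integrable.ae_eq_of_forall_setIntegral_eq _ _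
    ((Lp.memLp (accumulated t W).fst).integrable (by norm_num)) hFt.integral_prod_right
    fun E hE _ => ?_
  have h := inner_accumulated t W (WithLp.toLp 2 (ind l hE, 0))
  rw [SourceValue.inner_eq, inner_sepSource_left] at h
  change inner ℝ (ind l hE) (accumulated t W).fst + 0 * (accumulated t W).snd
    = inner ℝ (tensor _ (ind l hE)) W.fst + 0 * inner ℝ _ W.snd at h
  rw [zero_mul, zero_mul, add_zero, add_zero] at h
  have hm : (volume.restrict (Ioo 0 T ×ˢ Ioo 0 l)).restrict (Ioo 0 t ×ˢ E)
      = (volume.restrict (Ioo 0 t)).prod ((volume.restrict (Ioo 0 l)).restrict E) := by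
    rw [restrict_prod_eq, ← Measure.prod_restrict, Measure.restrict_restrict measurableSet_Ioo,
      inter_eq_left.2 (Ioo_subset_Ioo_right ht.2)]
  rw [MeasureTheory.L2.inner_indicatorConstLp_one, inner_tensor_ind, hm] at h
  rw [h, integral_prod_symm]
  exact hFt.mono_measure (Measure.prod_mono le_rfl Measure.restrict_le_self)

theorem accumulated_sepSource {t a : ℝ} (ht : t ∈ Icc 0 T) (ha : a ∈ Icc 0 T)
    (x : SourceValue l) :
    accumulated t (sepSource (ind T (measurableSet_Ioo (a := a) (b := T))) x)
      = max (t - a) 0 • x := by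
  refine ext_inner_left ℝ fun y => ?_
  rw [inner_accumulated, inner_sepSource, real_inner_comm, inner_ind_ind ha ht, inner_smul_right]

end Step

/-! ### Mild solutions as solutions of the abstract second-order equation. -/

section Mild

variable {l T : ℝ} [hl : Fact (0 < l)]

/-- The three component equations force `V = Z t - (Y₁ + ∫ (F, G, 0))`; `isB_iff` then turns the
condition on `∫ Y` into an equation with the bounded operator `adj`. -/
theorem isMildSolution_iff {Y₀ : H1 l} {Y₁ : LL l} {W : Source l T} {Y : ℝ → H1 l}
    {Z : ℝ → LL l} : IsMildSolution T Y₀ Y₁ W Y Z ↔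
      IsSecondOrderSolution emb adj T Y₀ (fun t => Y₁ + inLL l (accumulated t W)) Y Z := by
  have key : ContinuousOn Y (Icc 0 T) → ∀ t ∈ Icc 0 T,
      ((∃ V : LL l, IsB (∫ s in (0 : ℝ)..t, H1.toLL (Y s)) V ∧
        (∀ᵐ x ∂((volume : Measure ℝ).restrict (Ioo 0 l)),
          (Z t).fst x = Y₁.fst x + V.fst x + ∫ s in (0 : ℝ)..t, W.fst (s, x)) ∧
        (Z t).snd.fst = Y₁.snd.fst + V.snd.fst + ∫ s in (0 : ℝ)..t, W.snd s ∧
        (Z t).snd.snd = Y₁.snd.snd + V.snd.snd) ↔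
      ∫ s in (0 : ℝ)..t, Y s = adj ((∫ s in (0 : ℝ)..t, emb (Y s)) -
        (Z t - (Y₁ + inLL l (accumulated t W))))) := by
    intro hY t ht
    have hi := intervalIntegrable_of_continuousOn_Icc ht hY
    have hemb : emb (∫ s in (0 : ℝ)..t, Y s) = ∫ s in (0 : ℝ)..t, emb (Y s) :=
      (emb.intervalIntegral_comp_comm hi).symm
    have hV : ∀ V : LL l, ((∀ᵐ x ∂((volume : Measure ℝ).restrict (Ioo 0 l)),
          (Z t).fst x = Y₁.fst x + V.fst x + ∫ s in (0 : ℝ)..t, W.fst (s, x)) ∧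
        (Z t).snd.fst = Y₁.snd.fst + V.snd.fst + ∫ s in (0 : ℝ)..t, W.snd s ∧
        (Z t).snd.snd = Y₁.snd.snd + V.snd.snd) ↔
        V = Z t - (Y₁ + inLL l (accumulated t W)) := by
      intro V
      set P := inLL l (accumulated t W) with hP
      have hP1 : ∀ᵐ x ∂(volume.restrict (Ioo 0 l)), P.fst x = ∫ s in (0 : ℝ)..t, W.fst (s, x) :=
        accumulated_fst ht W
      have hP2 : P.snd.fst = ∫ s in (0 : ℝ)..t, W.snd s := accumulated_snd ht W
      have hP3 : P.snd.snd = 0 := rfl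
      rw [← hP2, eq_sub_iff_add_eq]
      have hsum : (V + (Y₁ + P)).fst = V.fst + (Y₁.fst + P.fst) := rfl
      have hae : ∀ᵐ x ∂(volume.restrict (Ioo 0 l)), (V + (Y₁ + P)).fst x
          = Y₁.fst x + V.fst x + ∫ s in (0 : ℝ)..t, W.fst (s, x) := by
        rw [hsum]
        filter_upwards [hP1, Lp.coeFn_add V.fst (Y₁.fst + P.fst), Lp.coeFn_add Y₁.fst P.fst]
          with x h1 h2 h3
        rw [h2, Pi.add_apply, h3, Pi.add_apply, h1]
        ring
      constructor
      · rintro ⟨h1, h2, h3⟩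
        apply WithLp.ofLp_injective
        refine Prod.ext ?_ ?_
        · apply Lp.ext
          filter_upwards [h1, hae] with x h4 h5
          exact h5.trans h4.symm
        · apply WithLp.ofLp_injective
          refine Prod.ext ?_ ?_
          · show V.snd.fst + (Y₁.snd.fst + P.snd.fst) = (Z t).snd.fst
            rw [h2]; ring
          · show V.snd.snd + (Y₁.snd.snd + P.snd.snd) = (Z t).snd.snd
            rw [h3, hP3]; ring
      · intro h
        rw [← h]
        refine ⟨hae, ?_, ?_⟩
        · show V.snd.fst + (Y₁.snd.fst + P.snd.fst) = _
          ring
        · show V.snd.snd + (Y₁.snd.snd + P.snd.snd) = _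
          rw [hP3]; ring
    simp only [hV]
    constructor
    · rintro ⟨V, hB, rfl⟩
      obtain ⟨y, hy, hy'⟩ := isB_iff.1 hB
      have : y = ∫ s in (0 : ℝ)..t, Y s := emb_injective (hy.trans hemb.symm)
      rw [← this]
      exact hy'
    · intro h
      exact ⟨_, isB_iff.2 ⟨_, hemb, h⟩, rfl⟩
  constructor
  · rintro ⟨h1, h2, h3, h4⟩
    exact ⟨h1, h2, h3, fun t ht => (key h1 t ht).1 (h4 t ht)⟩
  · rintro ⟨h1, h2, h3, h4⟩
    exact ⟨h1, h2, h3, fun t ht => (key h1 t ht).2 (h4 t ht)⟩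

end Mild

/-! ### Well-posedness, and affine dependence on the source. -/

section WellPosed

variable {l T : ℝ} [hl : Fact (0 < l)]

theorem IsMildSolution.unique {Y₀ : H1 l} {Y₁ : LL l} {W : Source l T} {Y Y' : ℝ → H1 l}
    {Z Z' : ℝ → LL l} (h : IsMildSolution T Y₀ Y₁ W Y Z) (h' : IsMildSolution T Y₀ Y₁ W Y' Z') :
    EqOn Y Y' (Icc 0 T) ∧ EqOn Z Z' (Icc 0 T) :=
  (isMildSolution_iff.1 h).unique adj_inner emb_injective adj_injective (isMildSolution_iff.1 h')

theorem IsMildSolution.add {Y₀ Y₀' : H1 l} {Y₁ Y₁' : LL l} {W W' : Source l T} {Y Y' : ℝ → H1 l}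
    {Z Z' : ℝ → LL l} (h : IsMildSolution T Y₀ Y₁ W Y Z)
    (h' : IsMildSolution T Y₀' Y₁' W' Y' Z') :
    IsMildSolution T (Y₀ + Y₀') (Y₁ + Y₁') (W + W') (fun t => Y t + Y' t) (fun t => Z t + Z' t) := by
  rw [isMildSolution_iff] at *
  have h3 := h.add h'
  have h2 : (fun t => Y₁ + inLL l (accumulated t W) + (Y₁' + inLL l (accumulated t W')))
      = fun t => Y₁ + Y₁' + inLL l (accumulated t (W + W')) := by
    funext t
    rw [map_add, map_add]
    abel
  rwa [h2] at h3

theorem IsMildSolution.smul {Y₀ : H1 l} {Y₁ : LL l} {W : Source l T} {Y : ℝ → H1 l}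
    {Z : ℝ → LL l} (h : IsMildSolution T Y₀ Y₁ W Y Z) (a : ℝ) :
    IsMildSolution T (a • Y₀) (a • Y₁) (a • W) (fun t => a • Y t) (fun t => a • Z t) := by
  rw [isMildSolution_iff] at *
  have h3 := h.smul a
  have h2 : (fun t => a • (Y₁ + inLL l (accumulated t W)))
      = fun t => a • Y₁ + inLL l (accumulated t (a • W)) := by
    funext t
    rw [map_smul, map_smul, smul_add]
  rwa [h2] at h3

theorem exists_isMildSolution_initial (T : ℝ) (Y₀ : H1 l) (Y₁ : LL l) :
    ∃ Y Z, IsMildSolution T Y₀ Y₁ 0 Y Z := by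
  obtain ⟨Y, Z, h⟩ := exists_isSecondOrderSolution_initial adj_inner emb_injective adj_injective
    T Y₀ Y₁
  refine ⟨Y, Z, isMildSolution_iff.2 ?_⟩
  have h2 : (fun t : ℝ => Y₁ + inLL l (accumulated (T := T) t 0)) = fun _ => Y₁ := by
    funext t
    rw [map_zero, map_zero, add_zero]
  rwa [h2]

theorem exists_isMildSolution_source (l : ℝ) [Fact (0 < l)] (hT : 0 < T) :
    ∃ C, 0 ≤ C ∧ ∀ W : Source l T,
    ∃ Y Z, IsMildSolution T 0 0 W Y Z ∧ ∀ t ∈ Icc 0 T, ‖Y t‖ ≤ C * ‖W‖ := by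
  obtain ⟨C, hC, h⟩ := exists_isSecondOrderSolution_source (V := H1 l) (H := LL l)
    (X := SourceValue l) (𝒲 := Source l T) adj_inner emb_injective
    adj_injective hT.le (inLL l)
    (σ := fun a => sepSource (ind T (measurableSet_Ioo (a := a) (b := T))))
    (Φ := fun t => inLL l ∘L accumulated t)
    (fun a ha b hb h k => by rw [inner_sepSource, inner_ind_ind_right ha hb])
    (fun t ht a ha h => by
      rw [ContinuousLinearMap.comp_apply, accumulated_sepSource ht ha, map_smul])
    (fun W hW => Source.eq_zero_of_forall_inner hT hW)
  refine ⟨C, hC, fun W => ?_⟩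
  obtain ⟨Y, Z, hYZ, hb⟩ := h W
  refine ⟨Y, Z, isMildSolution_iff.2 ?_, hb⟩
  have h2 : (fun t : ℝ => (0 : LL l) + inLL l (accumulated t W))
      = fun t => (inLL l ∘L accumulated t) W := by
    funext t
    rw [zero_add]
    rfl
  rwa [h2]

theorem exists_isMildSolution (hT : 0 < T) (Y₀ : H1 l) (Y₁ : LL l) (W : Source l T) :
    ∃ Y Z, IsMildSolution T Y₀ Y₁ W Y Z := by
  obtain ⟨Y, Z, h⟩ := exists_isMildSolution_initial T Y₀ Y₁
  obtain ⟨C, -, hC⟩ := exists_isMildSolution_source l hT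
  obtain ⟨Y', Z', h', -⟩ := hC W
  have := h.add h'
  rw [add_zero, add_zero, zero_add] at this
  exact ⟨_, _, this⟩

/-- By uniqueness the choice made in `displacement` does not matter at time `T`. -/
theorem IsMildSolution.finalDisplacement_eq (hT : 0 ≤ T) {Y₀ : H1 l} {Y₁ : LL l} {W : Source l T}
    {Y : ℝ → H1 l} {Z : ℝ → LL l} (h : IsMildSolution T Y₀ Y₁ W Y Z) :
    finalDisplacement T Y₀ Y₁ W = emb (Y T) := by
  have hex : ∃ Y : ℝ → H1 l, ∃ Z : ℝ → LL l, IsMildSolution T Y₀ Y₁ W Y Z := ⟨Y, Z, h⟩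
  obtain ⟨Z', h'⟩ := hex.choose_spec
  have h1 := (h'.unique h).1 (right_mem_Icc.2 hT)
  rw [finalDisplacement, displacement, dif_pos hex, h1]
  rfl

/-- The final displacement is a continuous affine function of the source, whose linear part is
the sensitivity. -/
theorem exists_finalDisplacement_eq (hT : 0 < T) (Y₀ : H1 l) (Y₁ : LL l) :
    ∃ (c : LL l) (L : Source l T →L[ℝ] LL l),
      (∀ W, finalDisplacement T Y₀ Y₁ W = c + L W) ∧ ∀ W, sensitivity T W = L W := by
  obtain ⟨Y, Z, h⟩ := exists_isMildSolution_initial T Y₀ Y₁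
  obtain ⟨C, hC0, hC⟩ := exists_isMildSolution_source l hT
  choose y z hyz hb using hC
  have hTm : T ∈ Icc 0 T := right_mem_Icc.2 hT.le
  have hadd : ∀ W W', y (W + W') T = y W T + y W' T := by
    intro W W'
    have := (hyz W).add (hyz W')
    rw [add_zero, add_zero] at this
    exact ((hyz (W + W')).unique this).1 hTm
  have hsmul : ∀ (a : ℝ) W, y (a • W) T = a • y W T := by
    intro a W
    have := (hyz W).smul a
    rw [smul_zero, smul_zero] at this
    exact ((hyz (a • W)).unique this).1 hTm
  let S : Source l T →L[ℝ] H1 l := LinearMap.mkContinuous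
    { toFun := fun W => y W T
      map_add' := hadd
      map_smul' := hsmul } C fun W => hb W T hTm
  have hS : ∀ W, S W = y W T := fun W => rfl
  refine ⟨emb (Y T), emb ∘L S, fun W => ?_, fun W => ?_⟩
  · have := h.add (hyz W)
    rw [add_zero, add_zero, zero_add] at this
    rw [this.finalDisplacement_eq hT.le, map_add]
    rfl
  · rw [sensitivity, (hyz W).finalDisplacement_eq hT.le]
    rfl

end WellPosed

/-! ### Minimizing convex functions on bounded closed convex sets. -/

section Optimization

variable {H : Type*} [NormedAddCommGroup H] [InnerProductSpace ℝ H]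

/-- A decreasing sequence of nonempty closed convex subsets of a bounded set in a Hilbert space has
a common point. -/
theorem exists_mem_iInter_of_antitone [CompleteSpace H] {C : ℕ → Set H} (hne : ∀ n, (C n).Nonempty)
    (hcl : ∀ n, IsClosed (C n)) (hcv : ∀ n, Convex ℝ (C n)) (hanti : Antitone C) {B : ℝ}
    (hB : ∀ x ∈ C 0, ‖x‖ ≤ B) : ∃ x, ∀ n, x ∈ C n := by
  have hmin : ∀ n, ∃ x ∈ C n, ∀ y ∈ C n, ‖x‖ ≤ ‖y‖ := by
    intro n
    obtain ⟨x, hx, hx'⟩ := exists_norm_eq_iInf_of_complete_convex (hne n) (hcl n).isComplete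
      (hcv n) 0
    refine ⟨x, hx, fun y hy => ?_⟩
    simp only [zero_sub, norm_neg] at hx'
    rw [hx']
    exact ciInf_le ⟨0, by rintro _ ⟨w, rfl⟩; exact norm_nonneg _⟩ (⟨y, hy⟩ : C n)
  choose x hx hxmin using hmin
  have hmono : Monotone fun n => ‖x n‖ := fun n m hnm => hxmin n _ (hanti hnm (hx m))
  have hbdd : BddAbove (range fun n => ‖x n‖) :=
    ⟨B, by rintro _ ⟨n, rfl⟩; exact hB _ (hanti (Nat.zero_le n) (hx n))⟩
  have hlim := tendsto_atTop_ciSup hmono hbdd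
  set r := ⨆ n, ‖x n‖ with hr
  -- The midpoint of `x n` and `x m` lies in `C n`, so its norm is at least `‖x n‖`; the
  -- parallelogram law does the rest.
  have hpar : ∀ n m, n ≤ m → ‖x n - x m‖ ^ 2 ≤ 2 * (r ^ 2 - ‖x n‖ ^ 2) := by
    intro n m hnm
    have h1 := parallelogram_law_with_norm ℝ (x n) (x m)
    have h2 : ‖x n‖ ≤ ‖(1 / 2 : ℝ) • x n + (1 / 2 : ℝ) • x m‖ :=
      hxmin n _ (hcv n (hx n) (hanti hnm (hx m)) (by norm_num) (by norm_num) (by norm_num))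
    rw [← smul_add, norm_smul, Real.norm_of_nonneg (by norm_num)] at h2
    have h3 : ‖x m‖ ≤ r := le_ciSup hbdd m
    nlinarith [norm_nonneg (x n), norm_nonneg (x m), norm_nonneg (x n + x m)]
  have hlim2 : Filter.Tendsto (fun n => √(2 * (r ^ 2 - ‖x n‖ ^ 2))) Filter.atTop (nhds 0) := by
    have := (((hlim.pow 2).const_sub (r ^ 2)).const_mul 2).sqrt
    simpa using this
  have hcauchy : CauchySeq x := by
    refine cauchySeq_of_le_tendsto_0 (fun n => 2 * √(2 * (r ^ 2 - ‖x n‖ ^ 2))) ?_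
      (by simpa using hlim2.const_mul 2)
    intro n m N hn hm
    have h1 : ∀ k, N ≤ k → dist (x N) (x k) ≤ √(2 * (r ^ 2 - ‖x N‖ ^ 2)) := fun k hk => by
      rw [dist_eq_norm]
      exact Real.le_sqrt_of_sq_le (by linarith [hpar N k hk])
    linarith [dist_triangle_left (x n) (x m) (x N), h1 n hn, h1 m hm]
  obtain ⟨y, hy⟩ := cauchySeq_tendsto_of_complete hcauchy
  exact ⟨y, fun n => (hcl n).mem_of_tendsto hy
    (Filter.eventually_atTop.2 ⟨n, fun m hm => hanti hm (hx m)⟩)⟩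

/-- A continuous convex function attains its minimum on a nonempty bounded closed convex subset of
a Hilbert space, if it is bounded below. -/
theorem exists_isMinOn_of_convexOn [CompleteSpace H] {K : Set H} (hne : K.Nonempty)
    (hcl : IsClosed K) {B : ℝ} (hB : ∀ x ∈ K, ‖x‖ ≤ B) {f : H → ℝ} (hf : ConvexOn ℝ K f)
    (hfc : ContinuousOn f K) (hf0 : ∀ x, 0 ≤ f x) : ∃ x ∈ K, IsMinOn f K x := by
  set m := sInf (f '' K) with hm
  have hbdd : BddBelow (f '' K) := ⟨0, by rintro _ ⟨x, -, rfl⟩; exact hf0 x⟩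
  obtain ⟨x, hx⟩ := exists_mem_iInter_of_antitone
    (C := fun n : ℕ => {x ∈ K | f x ≤ m + 1 / ((n : ℝ) + 1)})
    (fun n => by
      obtain ⟨_, ⟨x, hx, rfl⟩, hlt⟩ := exists_lt_of_csInf_lt (hne.image f)
        (lt_add_of_pos_right m (Nat.one_div_pos_of_nat (n := n)))
      exact ⟨x, hx, hlt.le⟩)
    (fun n => hfc.preimage_isClosed_of_isClosed hcl isClosed_Iic)
    (fun n => hf.convex_le _)
    (fun n k hnk x hx => ⟨hx.1, hx.2.trans (by gcongr)⟩)
    (fun x hx => hB x hx.1)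
  refine ⟨x, (hx 0).1, fun y hy => ?_⟩
  have h1 : f x ≤ m := by
    have h2 := (tendsto_one_div_add_atTop_nhds_zero_nat (𝕜 := ℝ)).const_add m
    rw [add_zero] at h2
    exact ge_of_tendsto' h2 fun n => (hx n).2
  exact h1.trans (csInf_le hbdd ⟨y, hy, rfl⟩)

theorem half_norm_sq_combo (x y : H) {a b : ℝ} (hab : a + b = 1) :
    1 / 2 * ‖a • x + b • y‖ ^ 2
      = a * (1 / 2 * ‖x‖ ^ 2) + b * (1 / 2 * ‖y‖ ^ 2) - a * b * (1 / 2 * ‖x - y‖ ^ 2) := by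
  rw [norm_add_sq_real, norm_sub_sq_real, norm_smul, norm_smul, inner_smul_left, inner_smul_right,
    mul_pow, mul_pow, Real.norm_eq_abs, Real.norm_eq_abs, sq_abs, sq_abs, conj_trivial]
  obtain rfl : b = 1 - a := by linarith
  ring

end Optimization

/-! ### The admissible set: closed, convex, nonempty, bounded. -/

section Admissible

variable {l T Fmin Fmax Gmin Gmax : ℝ}

/-- As order intervals of `Lp`, the constraints are closed by the order-closed topology. -/
theorem admissible_eq : admissible l T Fmin Fmax Gmin Gmax =
    {W : Source l T | W.fst ∈ Icc (Lp.const 2 _ Fmin) (Lp.const 2 _ Fmax) ∧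
      W.snd ∈ Icc (Lp.const 2 _ Gmin) (Lp.const 2 _ Gmax)} := by
  have key : ∀ {α : Type} [MeasurableSpace α] (μ : Measure α) [IsFiniteMeasure μ] (a b : ℝ)
      (f : Lp ℝ 2 μ), (∀ᵐ x ∂μ, a ≤ f x ∧ f x ≤ b) ↔
        f ∈ Icc (Lp.const 2 μ a) (Lp.const 2 μ b) := by
    intro α _ μ _ a b f
    rw [mem_Icc, ← Lp.coeFn_le, ← Lp.coeFn_le, Filter.EventuallyLE, Filter.EventuallyLE,
      ← Filter.eventually_and]
    refine Filter.eventually_congr ?_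
    filter_upwards [Lp.coeFn_const (E := ℝ) 2 μ a, Lp.coeFn_const (E := ℝ) 2 μ b] with x h1 h2
    rw [h1, h2]
    rfl
  ext W
  exact and_congr (key _ _ _ _) (key _ _ _ _)

theorem isClosed_admissible : IsClosed (admissible l T Fmin Fmax Gmin Gmax) := by
  rw [admissible_eq]
  exact (isClosed_Icc.preimage (WithLp.fstL 2 ℝ _ _).continuous).inter
    (isClosed_Icc.preimage (WithLp.sndL 2 ℝ _ _).continuous)

theorem convex_admissible : Convex ℝ (admissible l T Fmin Fmax Gmin Gmax) := by
  have key : ∀ {α : Type} [MeasurableSpace α] (μ : Measure α) (a b : ℝ) (f g : Lp ℝ 2 μ)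
      (r s : ℝ), 0 ≤ r → 0 ≤ s → r + s = 1 → (∀ᵐ x ∂μ, a ≤ f x ∧ f x ≤ b) →
      (∀ᵐ x ∂μ, a ≤ g x ∧ g x ≤ b) →
      ∀ᵐ x ∂μ, a ≤ (r • f + s • g : Lp ℝ 2 μ) x ∧ (r • f + s • g : Lp ℝ 2 μ) x ≤ b := by
    intro α _ μ a b f g r s hr hs hrs hf hg
    filter_upwards [hf, hg, Lp.coeFn_add (r • f) (s • g), Lp.coeFn_smul r f, Lp.coeFn_smul s g]
      with x h1 h2 h3 h4 h5
    rw [h3, Pi.add_apply, h4, h5]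
    exact convex_Icc a b h1 h2 hr hs hrs
  rintro W ⟨h1, h2⟩ W' ⟨h3, h4⟩ r s hr hs hrs
  exact ⟨key _ _ _ _ _ _ _ hr hs hrs h1 h3, key _ _ _ _ _ _ _ hr hs hrs h2 h4⟩

theorem nonempty_admissible (hF : Fmin ≤ Fmax) (hG : Gmin ≤ Gmax) :
    (admissible l T Fmin Fmax Gmin Gmax).Nonempty := by
  refine ⟨WithLp.toLp 2 (Lp.const 2 _ Fmin, Lp.const 2 _ Gmin), ?_, ?_⟩
  · filter_upwards [Lp.coeFn_const (E := ℝ) 2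
      ((volume : Measure (ℝ × ℝ)).restrict (Ioo 0 T ×ˢ Ioo 0 l)) Fmin] with x hx
    exact ⟨hx.ge, hx.le.trans hF⟩
  · filter_upwards [Lp.coeFn_const (E := ℝ) 2 (volume.restrict (Ioo 0 T)) Gmin] with x hx
    exact ⟨hx.ge, hx.le.trans hG⟩

theorem exists_norm_le_of_mem_admissible :
    ∃ B, ∀ W ∈ admissible l T Fmin Fmax Gmin Gmax, ‖W‖ ≤ B := by
  have key : ∀ {α : Type} [MeasurableSpace α] (μ : Measure α) [IsFiniteMeasure μ] (a b : ℝ),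
      ∃ B, ∀ f : Lp ℝ 2 μ, (∀ᵐ x ∂μ, a ≤ f x ∧ f x ≤ b) → ‖f‖ ≤ B := by
    intro α _ μ _ a b
    refine ⟨_, fun f hf => Lp.norm_le_of_ae_bound (C := max |a| |b|) (by positivity) ?_⟩
    filter_upwards [hf] with x hx
    exact abs_le_max_abs_abs hx.1 hx.2
  obtain ⟨B, hB⟩ := key ((volume : Measure (ℝ × ℝ)).restrict (Ioo 0 T ×ˢ Ioo 0 l)) Fmin Fmax
  obtain ⟨B', hB'⟩ := key ((volume : Measure ℝ).restrict (Ioo 0 T)) Gmin Gmax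
  refine ⟨B + B', fun W hW => ?_⟩
  have h1 := hB _ hW.1
  have h2 := hB' _ hW.2
  have h3 := WithLp.prod_norm_sq_eq_of_L2 W
  have h4 := norm_nonneg W.fst
  have h5 := norm_nonneg W.snd
  refine le_of_sq_le_sq ?_ (by linarith)
  rw [h3]
  nlinarith

end Admissible

/-! ### Convexity of the cost functional. -/

section Cost

variable {l T : ℝ} [hl : Fact (0 < l)]

theorem exists_cost_eq (hT : 0 < T) (Y₀ : H1 l) (Y₁ M : LL l) :
    ∃ (c : LL l) (L : Source l T →L[ℝ] LL l),
      (∀ W, cost T Y₀ Y₁ M W = 1 / 2 * ‖c + L W‖ ^ 2) ∧ ∀ W, sensitivity T W = L W := by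
  obtain ⟨c, L, h1, h2⟩ := exists_finalDisplacement_eq hT Y₀ Y₁
  refine ⟨c - M, L, fun W => ?_, h2⟩
  rw [cost, h1, sub_add_eq_add_sub]

theorem continuous_cost (hT : 0 < T) (Y₀ : H1 l) (Y₁ M : LL l) : Continuous (cost T Y₀ Y₁ M) := by
  obtain ⟨c, L, h1, -⟩ := exists_cost_eq hT Y₀ Y₁ M
  rw [funext h1]
  exact continuous_const.mul ((continuous_const.add L.continuous).norm.pow 2)

theorem cost_combo (hT : 0 < T) (Y₀ : H1 l) (Y₁ M : LL l) (W W' : Source l T) {a b : ℝ}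
    (hab : a + b = 1) : cost T Y₀ Y₁ M (a • W + b • W')
      = a * cost T Y₀ Y₁ M W + b * cost T Y₀ Y₁ M W'
        - a * b * (1 / 2 * ‖sensitivity T (W - W')‖ ^ 2) := by
  obtain ⟨c, L, h1, h2⟩ := exists_cost_eq hT Y₀ Y₁ M
  have h3 : c + L (a • W + b • W') = a • (c + L W) + b • (c + L W') := by
    rw [map_add, map_smul, map_smul, smul_add, smul_add, add_add_add_comm, ← add_smul, hab,
      one_smul]
  have h4 : L (W - W') = c + L W - (c + L W') := by
    rw [map_sub, add_sub_add_left_eq_sub]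
  rw [h1, h1, h1, h2, h3, h4]
  exact half_norm_sq_combo _ _ hab

theorem convexOn_cost (hT : 0 < T) (Y₀ : H1 l) (Y₁ M : LL l) {V : Set (Source l T)}
    (hV : Convex ℝ V) : ConvexOn ℝ V (cost T Y₀ Y₁ M) := by
  refine ⟨hV, fun W _ W' _ a b ha hb hab => ?_⟩
  rw [cost_combo hT Y₀ Y₁ M W W' hab, smul_eq_mul, smul_eq_mul]
  have : 0 ≤ a * b * (1 / 2 * ‖sensitivity T (W - W')‖ ^ 2) := by positivity
  linarith

theorem strictConvexOn_cost (hT : 0 < T) (Y₀ : H1 l) (Y₁ M : LL l) {V : Set (Source l T)}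
    (hV : Convex ℝ V) (hs : ∀ W ∈ V, ∀ δW : Source l T, δW ≠ 0 → W + δW ∈ V →
      0 < ‖sensitivity T δW‖ ^ 2) : StrictConvexOn ℝ V (cost T Y₀ Y₁ M) := by
  refine ⟨hV, fun W hW W' hW' hne a b ha hb hab => ?_⟩
  rw [cost_combo hT Y₀ Y₁ M W W' hab, smul_eq_mul, smul_eq_mul]
  -- The variation leads from `W'` to `W`, so both ends lie in `V`.
  have h1 := hs W' hW' (W - W') (sub_ne_zero.2 hne) (by rwa [add_sub_cancel])
  have : 0 < a * b * (1 / 2 * ‖sensitivity T (W - W')‖ ^ 2) := by positivity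
  linarith

end Cost

end DynamicWave

end

theorem mainTheorem6 (l T : ℝ) [Fact (0 < l)] (hT : 0 < T)
    (Fmin Fmax Gmin Gmax : ℝ) (hF : Fmin ≤ Fmax) (hG : Gmin ≤ Gmax)
    (Y₀ : DynamicWave.H1 l) (Y₁ M : DynamicWave.LL l) :
    -- the mild solution exists and is unique, so that the cost functional is well defined
    (∀ W : DynamicWave.Source l T,
      (∃ Y Z, DynamicWave.IsMildSolution T Y₀ Y₁ W Y Z) ∧
      (∀ Y Z Y' Z', DynamicWave.IsMildSolution T Y₀ Y₁ W Y Z →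
        DynamicWave.IsMildSolution T Y₀ Y₁ W Y' Z' →
        Set.EqOn Y Y' (Set.Icc 0 T) ∧ Set.EqOn Z Z' (Set.Icc 0 T))) ∧
    -- the set of admissible sources is closed and convex
    IsClosed (DynamicWave.admissible l T Fmin Fmax Gmin Gmax) ∧
    Convex ℝ (DynamicWave.admissible l T Fmin Fmax Gmin Gmax) ∧
    -- the cost functional is continuous and convex on it
    ContinuousOn (DynamicWave.cost T Y₀ Y₁ M)
      (DynamicWave.admissible l T Fmin Fmax Gmin Gmax) ∧
    ConvexOn ℝ (DynamicWave.admissible l T Fmin Fmax Gmin Gmax)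
      (DynamicWave.cost T Y₀ Y₁ M) ∧
    -- existence of a quasi-solution
    (∃ W, DynamicWave.IsQuasiSolution T Y₀ Y₁ M
      (DynamicWave.admissible l T Fmin Fmax Gmin Gmax) W) ∧
    -- strict convexity and uniqueness
    (∀ V ⊆ DynamicWave.admissible l T Fmin Fmax Gmin Gmax, IsClosed V → Convex ℝ V →
      (∀ W ∈ V, ∀ δW : DynamicWave.Source l T, δW ≠ 0 → W + δW ∈ V →
        0 < ‖DynamicWave.sensitivity T δW‖ ^ 2) →
      StrictConvexOn ℝ V (DynamicWave.cost T Y₀ Y₁ M) ∧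
      {W ∈ V | IsMinOn (DynamicWave.cost T Y₀ Y₁ M) V W}.Subsingleton ∧
      {W ∈ V | DynamicWave.IsQuasiSolution T Y₀ Y₁ M
        (DynamicWave.admissible l T Fmin Fmax Gmin Gmax) W}.Subsingleton) := by
  refine ⟨fun W => ⟨DynamicWave.exists_isMildSolution hT Y₀ Y₁ W, fun _ _ _ _ h h' => h.unique h'⟩,
    DynamicWave.isClosed_admissible, DynamicWave.convex_admissible,
    (DynamicWave.continuous_cost hT Y₀ Y₁ M).continuousOn,
    DynamicWave.convexOn_cost hT Y₀ Y₁ M DynamicWave.convex_admissible, ?_,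
    fun V hVU _ hV hs => ?_⟩
  · obtain ⟨B, hB⟩ := DynamicWave.exists_norm_le_of_mem_admissible (l := l) (T := T)
      (Fmin := Fmin) (Fmax := Fmax) (Gmin := Gmin) (Gmax := Gmax)
    exact DynamicWave.exists_isMinOn_of_convexOn (DynamicWave.nonempty_admissible hF hG)
      DynamicWave.isClosed_admissible hB
      (DynamicWave.convexOn_cost hT Y₀ Y₁ M DynamicWave.convex_admissible)
      (DynamicWave.continuous_cost hT Y₀ Y₁ M).continuousOn
      fun W => mul_nonneg (by norm_num) (sq_nonneg _)
  · have hstrict := DynamicWave.strictConvexOn_cost hT Y₀ Y₁ M hV hs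
    refine ⟨hstrict, fun W hW W' hW' => hstrict.eq_of_isMinOn hW.2 hW'.2 hW.1 hW'.1,
      fun W hW W' hW' => hstrict.eq_of_isMinOn ?_ ?_ hW.1 hW'.1⟩
    -- A quasi-solution lying in `V` minimizes over the larger admissible set, hence over `V`.
    · exact hW.2.2.on_subset hVU
    · exact hW'.2.2.on_subset hVU
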